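/- Let $\rho>0$, $T>0$, $\theta\ge 0$. For $N\in\mathbb N$, $N\ge1$, let $\tilde\Gamma$ be the lower triangular $(N+1)\times(N+1)$ matrix with $\tilde\Gamma_{ij}=0$ for $i<j$, $\tilde\Gamma_{ii}=1/2$, $\tilde\Gamma_{ij}=e^{-\rho(i-j)T/N}$ for $i>j$, and let $\Gamma=\tilde\Gamma+\tilde\Gamma^\top$. Put $$\boldsymbol\nu=(\Gamma+\tilde\Gamma+2\theta\,\mathrm{Id})^{-1}\mathbf 1,\qquad \boldsymbol\omega=(\Gamma-\tilde\Gamma+2\theta\,\mathrm{Id})^{-1}\mathbf 1,\qquad \boldsymbol v=\frac{\boldsymbol\nu}{\mathbf 1^\top\boldsymbol\nu},\qquad \boldsymbol w=\frac{\boldsymbol\omega}{\mathbf 1^\top\boldsymbol\omega},$$ and, with $n_t=\lceil Nt/T\rceil$, $$V^{(N)}_t=1-\sum_{k=1}^{n_t}v_k,\qquad W^{(N)}_t=1-\sum_{k=1}^{n_t}w_k,\qquad 0\le t\le T.$$ Then for every $N\ge1$ both matrices are invertible and $\boldsymbol v,\boldsymbol w$ are well defined with $\sum_{k=1}^{N+1}v_k=\sum_{k=1}^{N+1}w_k=1$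 (the inventories vanish after the final trade), and the following hold. (a) If $\theta>0$, then $V^{(N)}_0=1$ for all $N$ and, as $N\to\infty$, $$V^{(N)}_t\longrightarrow\frac{e^{3\rho T}(6\rho(T-t)+4)-4e^{3\rho t}}{2e^{3\rho T}(3\rho T+5)-1},\qquad 0<t\le T.$$ (b) Let $\theta=0$ and $$f_\pm(t)=\frac{\pm3e^{3\rho(T-t)}\pm6e^{3\rho(2T-t)}+e^{6\rho T}(6\rho(T-t)+4)+3\rho(T-t)+2e^{3\rho T}+4e^{3\rho t}-4e^{3\rho(T+t)}+3}{2e^{6\rho T}(3\rho T+5)+e^{3\rho T}+3\rho T+7},$$ $$g_\pm(t)=\frac{\pm3e^{3\rho(T-t)}\pm6e^{3\rho(2T-t)}+e^{6\rho T}(6\rho(T-t)+4)-3\rho(T-t)-2e^{3\rho T}-4e^{3\rho t}-4e^{3\rho(T+t)}-3}{2e^{6\rho T}(3\rho T+5)-3e^{3\rho T}-3\rho T-7}.$$ Then $V^{(N)}_0=1$ for all $N$, and for $0<t<T$ the sequence $(V^{(2N)}_t)_N$ has exactly the two distinct cluster points $f_+(t)$ and $f_-(t)$, and $(V^{(2N+1)}_t)_N$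 has exactly the two distinct cluster points $g_+(t)$ and $g_-(t)$. At $t=T$, $V^{(2N)}_T\to f_+(T)$ and $V^{(2N+1)}_T\to g_-(T)$. (c) If $\theta>0$, then, as $N\to\infty$, $$W^{(N)}_t\longrightarrow\frac{\rho(T-t)+1}{\rho T+1},\qquad 0\le t<T,$$ while $W^{(N)}_T\to\dfrac{1}{(2\theta+\frac12)(\rho T+1)}$. (d) Let $\theta=0$ and $$\varphi_\pm(t)=\frac{1+\rho(T-t)\pm e^{-\rho(T-t)}}{1+\rho T+e^{-\rho T}},\qquad \psi_\pm(t)=\frac{1+\rho(T-t)\pm e^{-\rho(T-t)}}{1+\rho T-e^{-\rho T}}.$$ Then $W^{(N)}_0=1$ for all $N$, and for $0<t<T$ the sequence $(W^{(2N)}_t)_N$ has exactly the two distinct cluster points $\varphi_+(t)$ and $\varphi_-(t)$, and $(W^{(2N+1)}_t)_N$ has exactly the two distinct cluster points $\psi_+(t)$ and $\psi_-(t)$. At $t=T$, $W^{(2N)}_T\to\varphi_+(T)$ and $W^{(2N+1)}_T\to\psi_+(T)$. -/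

import Mathlib

open Filter Topology

noncomputable section

namespace MarketImpact

/-- The lower triangular matrix `Γ̃` on the equidistant grid `kT/N`, `k = 0, …, N`:
`1/2` on the diagonal and `e^{-ρ(i-j)T/N}` below it. -/
def lowerKernel (ρ T : ℝ) (N : ℕ) : Matrix (Fin (N + 1)) (Fin (N + 1)) ℝ :=
  Matrix.of fun i j =>
    if i < j then 0
    else if i = j then 1 / 2
    else Real.exp (-ρ * (((i : ℕ) : ℝ) - ((j : ℕ) : ℝ)) * T / N)

/-- The Kac–Murdock–Szegő matrix `Γ = Γ̃ + Γ̃ᵀ`. -/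
def kms (ρ T : ℝ) (N : ℕ) : Matrix (Fin (N + 1)) (Fin (N + 1)) ℝ :=
  lowerKernel ρ T N + (lowerKernel ρ T N).transpose

/-- `Γ + Γ̃ + 2θ Id`. -/
def nuMatrix (ρ T θ : ℝ) (N : ℕ) : Matrix (Fin (N + 1)) (Fin (N + 1)) ℝ :=
  kms ρ T N + lowerKernel ρ T N + (2 * θ) • (1 : Matrix (Fin (N + 1)) (Fin (N + 1)) ℝ)

/-- `Γ - Γ̃ + 2θ Id`. -/
def omegaMatrix (ρ T θ : ℝ) (N : ℕ) : Matrix (Fin (N + 1)) (Fin (N + 1)) ℝ :=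
  kms ρ T N - lowerKernel ρ T N + (2 * θ) • (1 : Matrix (Fin (N + 1)) (Fin (N + 1)) ℝ)

/-- `ν = (Γ + Γ̃ + 2θ Id)⁻¹ 1`. -/
def nu (ρ T θ : ℝ) (N : ℕ) : Fin (N + 1) → ℝ :=
  (nuMatrix ρ T θ N)⁻¹.mulVec (fun _ => 1)

/-- `ω = (Γ - Γ̃ + 2θ Id)⁻¹ 1`. -/
def omega (ρ T θ : ℝ) (N : ℕ) : Fin (N + 1) → ℝ :=
  (omegaMatrix ρ T θ N)⁻¹.mulVec (fun _ => 1)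

/-- `v = ν / (1ᵀ ν)`; the entry at `k : Fin (N + 1)` is the trade at time `kT/N`. -/
def v (ρ T θ : ℝ) (N : ℕ) (k : Fin (N + 1)) : ℝ :=
  nu ρ T θ N k / ∑ i, nu ρ T θ N i

/-- `w = ω / (1ᵀ ω)`; the entry at `k : Fin (N + 1)` is the trade at time `kT/N`. -/
def w (ρ T θ : ℝ) (N : ℕ) (k : Fin (N + 1)) : ℝ :=
  omega ρ T θ N k / ∑ i, omega ρ T θ N i

/-- `n_t = ⌈N t / T⌉`. -/
def numTrades (T : ℝ) (N : ℕ) (t : ℝ) : ℕ := ⌈(N : ℝ) * t / T⌉₊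

/-- `V_t^{(N)}`: one minus the sum of the first `n_t` entries of `v`. -/
def V (ρ T θ : ℝ) (N : ℕ) (t : ℝ) : ℝ :=
  1 - ∑ k ∈ Finset.univ.filter (fun k : Fin (N + 1) => (k : ℕ) < numTrades T N t),
    v ρ T θ N k

/-- `W_t^{(N)}`: one minus the sum of the first `n_t` entries of `w`. -/
def W (ρ T θ : ℝ) (N : ℕ) (t : ℝ) : ℝ :=
  1 - ∑ k ∈ Finset.univ.filter (fun k : Fin (N + 1) => (k : ℕ) < numTrades T N t),
    w ρ T θ N k

/-- The limit of `V^{(N)}` for positive `θ`. -/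
def VLimit (ρ T t : ℝ) : ℝ :=
  (Real.exp (3 * ρ * T) * (6 * ρ * (T - t) + 4) - 4 * Real.exp (3 * ρ * t)) /
    (2 * Real.exp (3 * ρ * T) * (3 * ρ * T + 5) - 1)

/-- The limit of `W^{(N)}` for positive `θ`. -/
def WLimit (ρ T t : ℝ) : ℝ := (ρ * (T - t) + 1) / (ρ * T + 1)

/-- `f₊` for `s = 1` and `f₋` for `s = -1`. -/
def f (ρ T s t : ℝ) : ℝ :=
  (s * 3 * Real.exp (3 * ρ * (T - t)) + s * 6 * Real.exp (3 * ρ * (2 * T - t))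
      + Real.exp (6 * ρ * T) * (6 * ρ * (T - t) + 4) + 3 * ρ * (T - t)
      + 2 * Real.exp (3 * ρ * T) + 4 * Real.exp (3 * ρ * t)
      - 4 * Real.exp (3 * ρ * (T + t)) + 3) /
    (2 * Real.exp (6 * ρ * T) * (3 * ρ * T + 5) + Real.exp (3 * ρ * T) + 3 * ρ * T + 7)

/-- `g₊` for `s = 1` and `g₋` for `s = -1`. -/
def g (ρ T s t : ℝ) : ℝ :=
  (s * 3 * Real.exp (3 * ρ * (T - t)) + s * 6 * Real.exp (3 * ρ * (2 * T - t))
      + Real.exp (6 * ρ * T) * (6 * ρ * (T - t) + 4) - 3 * ρ * (T - t)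
      - 2 * Real.exp (3 * ρ * T) - 4 * Real.exp (3 * ρ * t)
      - 4 * Real.exp (3 * ρ * (T + t)) - 3) /
    (2 * Real.exp (6 * ρ * T) * (3 * ρ * T + 5) - 3 * Real.exp (3 * ρ * T) - 3 * ρ * T - 7)

/-- `φ₊` for `s = 1` and `φ₋` for `s = -1`. -/
def phi (ρ T s t : ℝ) : ℝ :=
  (1 + ρ * (T - t) + s * Real.exp (-ρ * (T - t))) / (1 + ρ * T + Real.exp (-ρ * T))

/-- `ψ₊` for `s = 1` and `ψ₋` for `s = -1`. -/
def psi (ρ T s t : ℝ) : ℝ :=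
  (1 + ρ * (T - t) + s * Real.exp (-ρ * (T - t))) / (1 + ρ * T - Real.exp (-ρ * T))

/-- The real sequence `u` has exactly the two (distinct) cluster points `a` and `b`. -/
def ExactlyTwoClusterPoints (u : ℕ → ℝ) (a b : ℝ) : Prop :=
  a ≠ b ∧ {x : ℝ | MapClusterPt x atTop u} = {a, b}

end MarketImpact

end

/-! Put `a` = e^{-ρT/N} and `d` = 3/2 + 2θ. The quadratic form of `lowerKernel` is a sum of squares
(`two_mul_sum_mul_discountedSum`), so both matrices have positive quadratic forms. They are
therefore invertible, and ν and ω are identified by guessing a solution and verifying the rows.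

The kernels are Toeplitz with geometric entries. Applied to `z ^ i`, the ν kernel returns a multiple
of `z ^ i` plus two boundary terms (`kernel_apply_pow`). The multiple vanishes at the two roots `x`,
`y` of a quadratic, so ν combines 1, `x ^ i`, `y ^ i` with coefficients that cancel the boundary
terms. The ω matrix is upper triangular, and back substitution gives a constant plus a multiple of
`r ^ (N - i)`, with `r = a * (1 - 1 / l)`, `l` = 1/2 + 2θ. Thus `V` and `W` are ratios of geometric
sums.

As N → ∞, `x` = 1 + 3ρT/N + o(1/N) for every θ, which produces the exponentials with rate 3ρ. The
roots `y` and `r` tend to limits of modulus below 1 when θ > 0, so their powers die out. When θ = 0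
one has exactly `y = -1/x` and `r = -a`, so their powers keep a sign given by the parity of the
exponent. `tendsto_V` and `tendsto_W` hold along any filter on which these powers converge. For 0 <
t < T both parities of n_t recur within the even and within the odd N
(`frequently_parity_numTrades`), hence exactly two cluster points. -/

noncomputable section

namespace MarketImpact

/-! ### Action of the triangular kernel and of its transpose -/

/-- The one-step decay factor `e^{-ρT/N}`. -/
def decay (ρ T : ℝ) (N : ℕ) : ℝ := Real.exp (-(ρ * T) / N)

lemma decay_pos (ρ T : ℝ) (N : ℕ) : 0 < decay ρ T N := Real.exp_pos _

lemma decay_lt_one {ρ T : ℝ} (hρ : 0 < ρ) (hT : 0 < T) {N : ℕ} (hN : 1 ≤ N) :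
    decay ρ T N < 1 := by
  have : (0 : ℝ) < N := by exact_mod_cast hN
  rw [decay, Real.exp_lt_one_iff, neg_div]
  have := div_pos (mul_pos hρ hT) this
  linarith

lemma exp_eq_decay_pow (ρ T : ℝ) (N : ℕ) {i j : ℕ} (h : j ≤ i) :
    Real.exp (-ρ * ((i : ℝ) - (j : ℝ)) * T / N) = decay ρ T N ^ (i - j) := by
  rw [decay, ← Real.exp_nat_mul, Nat.cast_sub h]
  congr 1
  ring

lemma lowerKernel_mulVec (ρ T : ℝ) (N : ℕ) (u : ℕ → ℝ) (i : Fin (N + 1)) :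
    (lowerKernel ρ T N).mulVec (fun k => u k) i =
      u i / 2 + ∑ j ∈ Finset.range i, decay ρ T N ^ ((i : ℕ) - j) * u j := by
  have key : ∀ j : Fin (N + 1), lowerKernel ρ T N i j * u j =
      (fun j : ℕ => (if j = i then u i / 2 else 0) +
        if j < i then decay ρ T N ^ ((i : ℕ) - j) * u j else 0) j := by
    intro j
    simp only [lowerKernel, Matrix.of_apply]
    rcases lt_trichotomy i j with h | h | h
    · have h' : (i : ℕ) < j := h
      simp [h, h'.ne', h'.not_gt]
    · subst h
      simp
      ring
    · have h' : (j : ℕ) < i := h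
      simp only [h.not_gt, h.ne', h', h'.ne, if_true, if_false, zero_add]
      rw [exp_eq_decay_pow _ _ _ h'.le]
  simp only [Matrix.mulVec, dotProduct]
  rw [Finset.sum_congr rfl fun j _ => key j, Fin.sum_univ_eq_sum_range
    (fun j : ℕ => (if j = i then u i / 2 else 0) +
        if j < i then decay ρ T N ^ ((i : ℕ) - j) * u j else 0), Finset.sum_add_distrib]
  congr 1
  · rw [Finset.sum_ite_eq', if_pos (Finset.mem_range.mpr i.isLt)]
  · rw [← Finset.sum_filter]
    apply Finset.sum_congr _ fun _ _ => rfl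
    ext j
    simp only [Finset.mem_filter, Finset.mem_range]
    omega

lemma lowerKernel_transpose_mulVec (ρ T : ℝ) (N : ℕ) (u : ℕ → ℝ) (i : Fin (N + 1)) :
    (lowerKernel ρ T N).transpose.mulVec (fun k => u k) i =
      u i / 2 + ∑ j ∈ Finset.Ico ((i : ℕ) + 1) (N + 1), decay ρ T N ^ (j - (i : ℕ)) * u j := by
  have key : ∀ j : Fin (N + 1), (lowerKernel ρ T N).transpose i j * u j =
      (fun j : ℕ => (if j = i then u i / 2 else 0) +
        if i < j then decay ρ T N ^ (j - (i : ℕ)) * u j else 0) j := by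
    intro j
    simp only [lowerKernel, Matrix.of_apply, Matrix.transpose_apply]
    rcases lt_trichotomy j i with h | h | h
    · have h' : (j : ℕ) < i := h
      simp [h, h'.ne, h'.not_gt]
    · subst h
      simp
      ring
    · have h' : (i : ℕ) < j := h
      simp only [h.not_gt, h.ne', h', h'.ne', if_true, if_false, zero_add]
      rw [exp_eq_decay_pow _ _ _ h'.le]
  simp only [Matrix.mulVec, dotProduct]
  rw [Finset.sum_congr rfl fun j _ => key j, Fin.sum_univ_eq_sum_range
    (fun j : ℕ => (if j = i then u i / 2 else 0) +
        if (i : ℕ) < j then decay ρ T N ^ (j - (i : ℕ)) * u j else 0), Finset.sum_add_distrib]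
  congr 1
  · rw [Finset.sum_ite_eq', if_pos (Finset.mem_range.mpr i.isLt)]
  · rw [← Finset.sum_filter]
    apply Finset.sum_congr _ fun _ _ => rfl
    ext j
    simp only [Finset.mem_filter, Finset.mem_range, Finset.mem_Ico]
    omega

/-! ### Positivity of the quadratic forms and invertibility -/

/-- The discounted running sum of the first `n` terms of `u`. -/
def discountedSum (a : ℝ) (u : ℕ → ℝ) (n : ℕ) : ℝ := ∑ j ∈ Finset.range n, a ^ (n - j) * u j

lemma discountedSum_succ (a : ℝ) (u : ℕ → ℝ) (n : ℕ) :
    discountedSum a u (n + 1) = a * (discountedSum a u n + u n) := by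
  rw [discountedSum, Finset.sum_range_succ, discountedSum, mul_add, Finset.mul_sum]
  congr 1
  · apply Finset.sum_congr rfl
    intro j hj
    rw [Nat.succ_sub (Finset.mem_range.mp hj).le, pow_succ]
    ring
  · simp

/-- With `D` the discounted sum and S_i = D_i + u_i, each term satisfies u_i² + 2 u_i D_i = S_i² -
D_i², and D_{i+1} = a S_i. Summation leaves only squares with nonnegative weights when |a| ≤ 1. -/
lemma two_mul_sum_mul_discountedSum (a : ℝ) (u : ℕ → ℝ) (n : ℕ) :
    2 * ∑ i ∈ Finset.range (n + 1), u i * (u i / 2 + discountedSum a u i) =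
      (discountedSum a u n + u n) ^ 2 +
        (1 - a ^ 2) * ∑ i ∈ Finset.range n, (discountedSum a u i + u i) ^ 2 := by
  induction n with
  | zero => simp [discountedSum]; ring
  | succ n ih =>
    rw [Finset.sum_range_succ, mul_add, ih, Finset.sum_range_succ _ n, discountedSum_succ]
    ring

lemma sum_mul_discountedSum_pos {a : ℝ} (ha : 0 < a) (ha1 : a < 1) (u : ℕ → ℝ) (n : ℕ)
    (hu : ∃ i ≤ n, u i ≠ 0) :
    0 < ∑ i ∈ Finset.range (n + 1), u i * (u i / 2 + discountedSum a u i) := by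
  by_contra hneg
  have h1 := two_mul_sum_mul_discountedSum a u n
  have hc : 0 < 1 - a ^ 2 := by nlinarith
  have hs : 0 ≤ ∑ i ∈ Finset.range n, (discountedSum a u i + u i) ^ 2 :=
    Finset.sum_nonneg fun _ _ => sq_nonneg _
  have hlast : (discountedSum a u n + u n) ^ 2 = 0 := by
    nlinarith [sq_nonneg (discountedSum a u n + u n), mul_nonneg hc.le hs]
  have hsum : ∑ i ∈ Finset.range n, (discountedSum a u i + u i) ^ 2 = 0 := by
    nlinarith [sq_nonneg (discountedSum a u n + u n), mul_nonneg hc.le hs]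
  rw [Finset.sum_eq_zero_iff_of_nonneg fun _ _ => sq_nonneg _] at hsum
  -- All S_i vanish, so every later D_{i+1} = a S_i vanishes too, and with it `u`.
  have hz : ∀ i ≤ n, discountedSum a u i + u i = 0 := by
    intro i hi
    rcases hi.eq_or_lt with rfl | hlt
    · exact pow_eq_zero_iff two_ne_zero |>.mp hlast
    · exact pow_eq_zero_iff two_ne_zero |>.mp (hsum i (Finset.mem_range.mpr hlt))
  obtain ⟨i, hi, hne⟩ := hu
  apply hne
  have hi' := hz i hi
  cases i with
  | zero => simpa [discountedSum] using hi'
  | succ k =>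
    rw [discountedSum_succ, hz k (by omega)] at hi'
    simpa using hi'

lemma dotProduct_lowerKernel_pos {ρ T : ℝ} (hρ : 0 < ρ) (hT : 0 < T) {N : ℕ} (hN : 1 ≤ N)
    {z : Fin (N + 1) → ℝ} (hz : z ≠ 0) : 0 < z ⬝ᵥ (lowerKernel ρ T N).mulVec z := by
  obtain ⟨u, rfl⟩ : ∃ u : ℕ → ℝ, z = fun k : Fin (N + 1) => u k :=
    ⟨fun n => if h : n < N + 1 then z ⟨n, h⟩ else 0, by ext k; simp only [k.isLt, dif_pos]⟩
  have h := sum_mul_discountedSum_pos (decay_pos ρ T N) (decay_lt_one hρ hT hN) u N (by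
    obtain ⟨k, hk⟩ := Function.ne_iff.mp hz
    exact ⟨k, by omega, hk⟩)
  rw [← Fin.sum_univ_eq_sum_range
    (fun i => u i * (u i / 2 + discountedSum (decay ρ T N) u i))] at h
  simpa only [dotProduct, lowerKernel_mulVec, discountedSum] using h

lemma dotProduct_transpose_mulVec_self {n : Type*} [Fintype n] (A : Matrix n n ℝ) (z : n → ℝ) :
    z ⬝ᵥ A.transpose.mulVec z = z ⬝ᵥ A.mulVec z := by
  rw [Matrix.mulVec_transpose, dotProduct_comm, Matrix.dotProduct_mulVec]

/-- A matrix and its transpose have the same quadratic form, so this form is three times that of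
`lowerKernel` plus 2θ|z|². For `omegaMatrix` the factor three becomes one. -/
lemma dotProduct_nuMatrix_pos {ρ T θ : ℝ} (hρ : 0 < ρ) (hT : 0 < T) (hθ : 0 ≤ θ) {N : ℕ}
    (hN : 1 ≤ N) {z : Fin (N + 1) → ℝ} (hz : z ≠ 0) :
    0 < z ⬝ᵥ (nuMatrix ρ T θ N).mulVec z := by
  have h := dotProduct_lowerKernel_pos hρ hT hN hz
  have h2 : 0 ≤ z ⬝ᵥ z := Finset.sum_nonneg fun _ _ => mul_self_nonneg _
  simp only [nuMatrix, kms, Matrix.add_mulVec, Matrix.smul_mulVec, Matrix.one_mulVec,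
    dotProduct_add, dotProduct_smul, dotProduct_transpose_mulVec_self, smul_eq_mul]
  nlinarith [mul_nonneg hθ h2]

lemma dotProduct_omegaMatrix_pos {ρ T θ : ℝ} (hρ : 0 < ρ) (hT : 0 < T) (hθ : 0 ≤ θ) {N : ℕ}
    (hN : 1 ≤ N) {z : Fin (N + 1) → ℝ} (hz : z ≠ 0) :
    0 < z ⬝ᵥ (omegaMatrix ρ T θ N).mulVec z := by
  have h := dotProduct_lowerKernel_pos hρ hT hN hz
  have h2 : 0 ≤ z ⬝ᵥ z := Finset.sum_nonneg fun _ _ => mul_self_nonneg _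
  simp only [omegaMatrix, kms, Matrix.add_mulVec, Matrix.sub_mulVec, Matrix.smul_mulVec,
    Matrix.one_mulVec, dotProduct_add, dotProduct_sub, dotProduct_smul,
    dotProduct_transpose_mulVec_self, smul_eq_mul]
  nlinarith [mul_nonneg hθ h2]

lemma isUnit_det_of_dotProduct_pos {n : Type*} [Fintype n] [DecidableEq n] {A : Matrix n n ℝ}
    (hA : ∀ z, z ≠ 0 → 0 < z ⬝ᵥ A.mulVec z) : IsUnit A.det := by
  rw [isUnit_iff_ne_zero]
  intro h
  obtain ⟨z, hz, hAz⟩ := Matrix.exists_mulVec_eq_zero_iff.mpr h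
  have := hA z hz
  simp [hAz] at this

/-- If A z = 1, then 1ᵀz = zᵀA z, which is positive since z ≠ 0. This makes the normalization of `v`
and `w` legitimate. -/
lemma sum_inv_mulVec_one_pos {n : Type*} [Fintype n] [DecidableEq n] [Nonempty n]
    {A : Matrix n n ℝ} (hA : ∀ z, z ≠ 0 → 0 < z ⬝ᵥ A.mulVec z) :
    0 < ∑ i, A⁻¹.mulVec (fun _ => 1) i := by
  have hdet := isUnit_det_of_dotProduct_pos hA
  set z := A⁻¹.mulVec (fun _ => (1 : ℝ)) with hz
  have hAz : A.mulVec z = fun _ => 1 := by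
    rw [hz, Matrix.mulVec_mulVec, Matrix.mul_nonsing_inv _ hdet, Matrix.one_mulVec]
  have hz0 : z ≠ 0 := by
    intro h
    rw [h, Matrix.mulVec_zero] at hAz
    exact zero_ne_one (congrFun hAz (Classical.arbitrary n))
  have := hA z hz0
  rw [hAz] at this
  simpa [dotProduct] using this

lemma inv_mulVec_eq {n : Type*} [Fintype n] [DecidableEq n] {A : Matrix n n ℝ}
    (hA : IsUnit A.det) {z b : n → ℝ} (h : A.mulVec z = b) : A⁻¹.mulVec b = z := by
  rw [← h, Matrix.mulVec_mulVec, Matrix.nonsing_inv_mul _ hA, Matrix.one_mulVec]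

/-! ### Row equations for ν and ω, normalization, inventories as ratios of sums -/

lemma nu_eq_of_forall {ρ T θ : ℝ} (hρ : 0 < ρ) (hT : 0 < T) (hθ : 0 ≤ θ) {N : ℕ}
    (hN : 1 ≤ N) (u : ℕ → ℝ)
    (hu : ∀ i ≤ N, (3 / 2 + 2 * θ) * u i
      + ∑ j ∈ Finset.Ico (i + 1) (N + 1), decay ρ T N ^ (j - i) * u j
      + 2 * ∑ j ∈ Finset.range i, decay ρ T N ^ (i - j) * u j = 1) :
    nu ρ T θ N = fun k : Fin (N + 1) => u k := by
  apply inv_mulVec_eq (isUnit_det_of_dotProduct_pos fun z hz =>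
    dotProduct_nuMatrix_pos hρ hT hθ hN hz)
  ext i
  rw [← hu i (by omega)]
  simp only [nuMatrix, kms, Matrix.add_mulVec, Matrix.smul_mulVec, Matrix.one_mulVec,
    Pi.add_apply, Pi.smul_apply, smul_eq_mul, lowerKernel_mulVec, lowerKernel_transpose_mulVec]
  ring

lemma omega_eq_of_forall {ρ T θ : ℝ} (hρ : 0 < ρ) (hT : 0 < T) (hθ : 0 ≤ θ) {N : ℕ}
    (hN : 1 ≤ N) (u : ℕ → ℝ)
    (hu : ∀ i ≤ N, (1 / 2 + 2 * θ) * u i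
      + ∑ j ∈ Finset.Ico (i + 1) (N + 1), decay ρ T N ^ (j - i) * u j = 1) :
    omega ρ T θ N = fun k : Fin (N + 1) => u k := by
  apply inv_mulVec_eq (isUnit_det_of_dotProduct_pos fun z hz =>
    dotProduct_omegaMatrix_pos hρ hT hθ hN hz)
  ext i
  rw [← hu i (by omega)]
  simp only [omegaMatrix, kms, Matrix.add_mulVec, Matrix.sub_mulVec, Matrix.smul_mulVec,
    Matrix.one_mulVec, Pi.add_apply, Pi.sub_apply, Pi.smul_apply, smul_eq_mul,
    lowerKernel_mulVec, lowerKernel_transpose_mulVec]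
  ring

lemma sum_nu_pos {ρ T θ : ℝ} (hρ : 0 < ρ) (hT : 0 < T) (hθ : 0 ≤ θ) {N : ℕ} (hN : 1 ≤ N) :
    0 < ∑ k, nu ρ T θ N k :=
  sum_inv_mulVec_one_pos fun _ hz => dotProduct_nuMatrix_pos hρ hT hθ hN hz

lemma sum_omega_pos {ρ T θ : ℝ} (hρ : 0 < ρ) (hT : 0 < T) (hθ : 0 ≤ θ) {N : ℕ} (hN : 1 ≤ N) :
    0 < ∑ k, omega ρ T θ N k :=
  sum_inv_mulVec_one_pos fun _ hz => dotProduct_omegaMatrix_pos hρ hT hθ hN hz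

lemma sum_v_eq_one {ρ T θ : ℝ} (hρ : 0 < ρ) (hT : 0 < T) (hθ : 0 ≤ θ) {N : ℕ} (hN : 1 ≤ N) :
    ∑ k, v ρ T θ N k = 1 := by
  simp only [v]
  rw [← Finset.sum_div, div_self (sum_nu_pos hρ hT hθ hN).ne']

lemma sum_w_eq_one {ρ T θ : ℝ} (hρ : 0 < ρ) (hT : 0 < T) (hθ : 0 ≤ θ) {N : ℕ} (hN : 1 ≤ N) :
    ∑ k, w ρ T θ N k = 1 := by
  simp only [w]
  rw [← Finset.sum_div, div_self (sum_omega_pos hρ hT hθ hN).ne']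

lemma V_zero (ρ T θ : ℝ) (N : ℕ) : V ρ T θ N 0 = 1 := by
  simp [V, numTrades]

lemma W_zero (ρ T θ : ℝ) (N : ℕ) : W ρ T θ N 0 = 1 := by
  simp [W, numTrades]

lemma sum_filter_lt_fin {N n : ℕ} (hn : n ≤ N) (u : ℕ → ℝ) :
    ∑ k ∈ Finset.univ.filter (fun k : Fin (N + 1) => (k : ℕ) < n), u k =
      ∑ k ∈ Finset.range n, u k := by
  rw [Finset.sum_filter, Fin.sum_univ_eq_sum_range (fun k => if k < n then u k else 0),
    ← Finset.sum_filter]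
  apply Finset.sum_congr _ fun _ _ => rfl
  ext j
  simp only [Finset.mem_filter, Finset.mem_range]
  omega

lemma numTrades_le {T : ℝ} (hT : 0 < T) (N : ℕ) {t : ℝ} (ht : t ≤ T) : numTrades T N t ≤ N := by
  rw [numTrades, Nat.ceil_le, div_le_iff₀ hT]
  exact mul_le_mul_of_nonneg_left ht (Nat.cast_nonneg N)

lemma numTrades_self {T : ℝ} (hT : 0 < T) (N : ℕ) : numTrades T N T = N := by
  rw [numTrades, mul_div_assoc, div_self hT.ne', mul_one, Nat.ceil_natCast]

lemma V_eq_of_nu_eq {ρ T θ t : ℝ} (hT : 0 < T) (ht : t ≤ T) {N : ℕ} {u : ℕ → ℝ}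
    (hu : nu ρ T θ N = fun k : Fin (N + 1) => u k) :
    V ρ T θ N t = 1 - (∑ k ∈ Finset.range (numTrades T N t), u k) /
      ∑ k ∈ Finset.range (N + 1), u k := by
  simp only [V, v]
  rw [← Finset.sum_div, hu, sum_filter_lt_fin (numTrades_le hT N ht), Fin.sum_univ_eq_sum_range]

lemma W_eq_of_omega_eq {ρ T θ t : ℝ} (hT : 0 < T) (ht : t ≤ T) {N : ℕ} {u : ℕ → ℝ}
    (hu : omega ρ T θ N = fun k : Fin (N + 1) => u k) :
    W ρ T θ N t = 1 - (∑ k ∈ Finset.range (numTrades T N t), u k) /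
      ∑ k ∈ Finset.range (N + 1), u k := by
  simp only [W, w]
  rw [← Finset.sum_div, hu, sum_filter_lt_fin (numTrades_le hT N ht), Fin.sum_univ_eq_sum_range]

/-! ### Explicit solutions of the two linear systems -/

lemma discountedSum_pow {a z : ℝ} (h : z ≠ a) (i : ℕ) :
    discountedSum a (fun j => z ^ j) i = a * (z ^ i - a ^ i) / (z - a) := by
  have h' : z - a ≠ 0 := sub_ne_zero.mpr h
  induction i with
  | zero => simp [discountedSum]
  | succ i ih =>
    rw [discountedSum_succ, ih]
    field_simp
    ring

lemma sum_Ico_pow_mul_pow {a z : ℝ} (h : a * z ≠ 1) (i m : ℕ) :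
    ∑ j ∈ Finset.Ico (i + 1) (i + m + 1), a ^ (j - i) * z ^ j =
      (a * z ^ (i + 1) - a ^ (m + 1) * z ^ (i + m + 1)) / (1 - a * z) := by
  have h' : 1 - a * z ≠ 0 := sub_ne_zero.mpr h.symm
  induction m with
  | zero => simp
  | succ m ih =>
    rw [← add_assoc, Finset.sum_Ico_succ_top (by omega), ih,
      show i + m + 1 - i = m + 1 by omega]
    field_simp
    ring

/-- The two error terms depend on `i` only through `a ^ (N - i + 1)` and `a ^ (i + 1)`, whatever `z`
is. A superposition of three geometric sequences can therefore cancel them with just two scalar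
conditions. -/
lemma kernel_apply_pow {a d z : ℝ} (h1 : z ≠ a) (h2 : a * z ≠ 1) {i N : ℕ} (hi : i ≤ N) :
    d * z ^ i + ∑ j ∈ Finset.Ico (i + 1) (N + 1), a ^ (j - i) * z ^ j
        + 2 * ∑ j ∈ Finset.range i, a ^ (i - j) * z ^ j =
      (d + a * z / (1 - a * z) + 2 * a / (z - a)) * z ^ i
        - a ^ (N - i + 1) * (z ^ (N + 1) / (1 - a * z)) - 2 * a ^ (i + 1) * (1 / (z - a)) := by
  obtain ⟨m, rfl⟩ := Nat.exists_eq_add_of_le hi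
  have h3 := discountedSum_pow h1 i
  rw [discountedSum] at h3
  have h1' : z - a ≠ 0 := sub_ne_zero.mpr h1
  have h2' : 1 - a * z ≠ 0 := sub_ne_zero.mpr h2.symm
  rw [h3, sum_Ico_pow_mul_pow h2, Nat.add_sub_cancel_left]
  field_simp
  ring

/-- If `x` and `y` are characteristic roots and the two boundary conditions hold, then
`1 + α x ^ i + (B / (1 - a)) y ^ i` solves the linear system up to a constant factor. -/
lemma kernel_apply_solution {a d x y α B : ℝ} {N : ℕ} (ha : a ≠ 1) (hd : d * (1 - a) + 3 * a ≠ 0)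
    (hxa : x ≠ a) (hax : a * x ≠ 1) (hya : y ≠ a) (hay : a * y ≠ 1)
    (hx : d + a * x / (1 - a * x) + 2 * a / (x - a) = 0)
    (hy : d + a * y / (1 - a * y) + 2 * a / (y - a) = 0)
    (hl : 1 + α * ((1 - a) / (x - a)) + B * (1 / (y - a)) = 0)
    (hr : 1 + α * ((1 - a) / (1 - a * x) * x ^ (N + 1)) + B * (y ^ (N + 1) / (1 - a * y)) = 0)
    {i : ℕ} (hi : i ≤ N) (u : ℕ → ℝ)
    (hu : u = fun i => (1 - a) / (d * (1 - a) + 3 * a) *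
      (1 + α * x ^ i + B / (1 - a) * y ^ i)) :
    d * u i + ∑ j ∈ Finset.Ico (i + 1) (N + 1), a ^ (j - i) * u j
        + 2 * ∑ j ∈ Finset.range i, a ^ (i - j) * u j = 1 := by
  have ha' : 1 - a ≠ 0 := sub_ne_zero.mpr ha.symm
  have e1 := kernel_apply_pow (d := d) (z := 1) ha.symm (by simpa using ha) hi
  have ex := kernel_apply_pow (d := d) hxa hax hi
  have ey := kernel_apply_pow (d := d) hya hay hi
  rw [hx] at ex
  rw [hy] at ey
  simp only [one_pow, mul_one] at e1
  -- The inverse of the multiplier at `z = 1`, where the constant sequence must produce the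
  -- right-hand side 1.
  set c := (1 - a) / (d * (1 - a) + 3 * a) with hc
  have hcd : c * (d + a / (1 - a) + 2 * a / (1 - a)) = 1 := by
    rw [hc, div_mul_eq_mul_div, div_eq_one_iff_eq hd]
    field_simp
    ring
  have s1 : ∑ j ∈ Finset.Ico (i + 1) (N + 1), a ^ (j - i) * u j =
      c * (∑ j ∈ Finset.Ico (i + 1) (N + 1), a ^ (j - i)
        + α * ∑ j ∈ Finset.Ico (i + 1) (N + 1), a ^ (j - i) * x ^ j
        + B / (1 - a) * ∑ j ∈ Finset.Ico (i + 1) (N + 1), a ^ (j - i) * y ^ j) := by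
    simp only [Finset.mul_sum, ← Finset.sum_add_distrib, hu]
    exact Finset.sum_congr rfl fun _ _ => by ring
  have s2 : ∑ j ∈ Finset.range i, a ^ (i - j) * u j =
      c * (∑ j ∈ Finset.range i, a ^ (i - j)
        + α * ∑ j ∈ Finset.range i, a ^ (i - j) * x ^ j
        + B / (1 - a) * ∑ j ∈ Finset.range i, a ^ (i - j) * y ^ j) := by
    simp only [Finset.mul_sum, ← Finset.sum_add_distrib, hu]
    exact Finset.sum_congr rfl fun _ _ => by ring
  -- The boundary conditions were assumed multiplied by `1 - a`, the scaling in which `α` and `B`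
  -- converge as `a → 1`; here the factor is removed.
  have hl' : 1 / (1 - a) + α * (1 / (x - a)) + B / (1 - a) * (1 / (y - a)) = 0 := by
    have : 1 / (1 - a) + α * (1 / (x - a)) + B / (1 - a) * (1 / (y - a)) =
      (1 + α * ((1 - a) / (x - a)) + B * (1 / (y - a))) / (1 - a) := by
      field_simp
    rw [this, hl, zero_div]
  have hr' : 1 / (1 - a) + α * (x ^ (N + 1) / (1 - a * x))
      + B / (1 - a) * (y ^ (N + 1) / (1 - a * y)) = 0 := by
    have : 1 / (1 - a) + α * (x ^ (N + 1) / (1 - a * x))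
        + B / (1 - a) * (y ^ (N + 1) / (1 - a * y)) =
      (1 + α * ((1 - a) / (1 - a * x) * x ^ (N + 1)) + B * (y ^ (N + 1) / (1 - a * y)))
        / (1 - a) := by
      field_simp
    rw [this, hr, zero_div]
  have hui : u i = c * (1 + α * x ^ i + B / (1 - a) * y ^ i) := by rw [hu]
  rw [s1, s2, hui]
  linear_combination c * e1 + c * α * ex + c * (B / (1 - a)) * ey
    - c * a ^ (N - i + 1) * hr' - 2 * c * a ^ (i + 1) * hl' + hcd

lemma sum_range_solution {a d x y α B : ℝ} (ha : a ≠ 1) (hx : x ≠ 1) (hy : y ≠ 1) (n : ℕ) :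
    ∑ i ∈ Finset.range n, (1 - a) / (d * (1 - a) + 3 * a) *
      (1 + α * x ^ i + B / (1 - a) * y ^ i) =
    1 / (d * (1 - a) + 3 * a) * (n * (1 - a) + α * ((1 - a) / (x - 1) * (x ^ n - 1))
      + B * ((1 - y ^ n) / (1 - y))) := by
  have ha' : 1 - a ≠ 0 := sub_ne_zero.mpr ha.symm
  have hy' : 1 - y ≠ 0 := sub_ne_zero.mpr hy.symm
  rw [← Finset.mul_sum, Finset.sum_add_distrib, Finset.sum_add_distrib, ← Finset.mul_sum,
    ← Finset.mul_sum, geom_sum_eq hx, geom_sum_eq hy, Finset.sum_const, Finset.card_range,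
    nsmul_eq_mul, ← neg_sub 1 y, ← neg_sub 1 (y ^ n), neg_div_neg_eq]
  field_simp

/-- The quadratic is the multiplier of `kernel_apply_pow` with denominators cleared. At `x = a` its
negative equals `2a(1 - a²) ≠ 0`; and `a * x = 1` would force `x = a`. So no root is a pole. -/
lemma characteristic_root {a d x : ℝ} (ha : 0 < a) (ha1 : a < 1)
    (hx : a * (d - 1) * x ^ 2 - (d + (d - 3) * a ^ 2) * x - (2 - d) * a = 0) :
    x ≠ a ∧ a * x ≠ 1 ∧ d + a * x / (1 - a * x) + 2 * a / (x - a) = 0 := by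
  have hp : d * (1 - a * x) * (x - a) + a * x * (x - a) + 2 * a * (1 - a * x) = 0 := by
    linear_combination -hx
  have hc : 0 < 1 - a ^ 2 := by nlinarith
  have h1 : x ≠ a := by
    rintro rfl
    have : 2 * x * (1 - x ^ 2) = 0 := by linear_combination hp
    have := mul_pos ha hc
    linarith
  have h2 : a * x ≠ 1 := by
    intro h
    have h3 : x - a = 0 := by
      rw [h] at hp
      linear_combination hp
    exact h1 (sub_eq_zero.mp h3)
  refine ⟨h1, h2, ?_⟩
  have h1' : x - a ≠ 0 := sub_ne_zero.mpr h1
  have h2' : 1 - a * x ≠ 0 := sub_ne_zero.mpr h2.symm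
  field_simp
  linear_combination hp

lemma sum_Ico_pow_mul_pow_sub {a r : ℝ} (h : a ≠ r) (i m : ℕ) :
    ∑ j ∈ Finset.Ico (i + 1) (i + m + 1), a ^ (j - i) * r ^ (i + m - j) =
      a * ((a ^ m - r ^ m) / (a - r)) := by
  rw [← geom₂_sum h, Finset.sum_Ico_eq_sum_range, Finset.mul_sum,
    show i + m + 1 - (i + 1) = m by omega]
  apply Finset.sum_congr rfl
  intro k hk
  rw [show i + 1 + k - i = k + 1 by omega, show i + m - (i + 1 + k) = m - 1 - k by omega]
  ring

/-- Subtracting `a` times row `i + 1` from row `i` gives u_i = (1 - a)/l + r u_{i+1}, with u_N =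
1/l. The constant part of `u` is the fixed point of this recursion. -/
lemma kernel_apply_solution_omega {a l r : ℝ} {N : ℕ} (ha : 0 < a) (ha1 : a < 1)
    (hl : 0 < l) (hr : r = a * (1 - 1 / l)) (hr1 : r ≠ 1) {i : ℕ} (hi : i ≤ N) (u : ℕ → ℝ)
    (hu : u = fun i => (1 - a) / (l * (1 - r)) + a / (l ^ 2 * (1 - r)) * r ^ (N - i)) :
    l * u i + ∑ j ∈ Finset.Ico (i + 1) (N + 1), a ^ (j - i) * u j = 1 := by
  obtain ⟨m, rfl⟩ := Nat.exists_eq_add_of_le hi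
  have hra : a - r = a / l := by rw [hr]; field_simp; ring
  have har : a ≠ r := by
    rw [ne_eq, ← sub_eq_zero, hra]
    positivity
  have h1a : 1 - a ≠ 0 := by linarith
  have h1r : 1 - r ≠ 0 := sub_ne_zero.mpr hr1.symm
  have s0 := sum_Ico_pow_mul_pow (a := a) (z := 1) (by simpa using ha1.ne) i m
  have s1 := sum_Ico_pow_mul_pow_sub har i m
  simp only [one_pow, mul_one] at s0
  have s2 : ∑ j ∈ Finset.Ico (i + 1) (i + m + 1), a ^ (j - i) * u j =
      (1 - a) / (l * (1 - r)) * ∑ j ∈ Finset.Ico (i + 1) (i + m + 1), a ^ (j - i)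
        + a / (l ^ 2 * (1 - r)) *
          ∑ j ∈ Finset.Ico (i + 1) (i + m + 1), a ^ (j - i) * r ^ (i + m - j) := by
    simp only [Finset.mul_sum, ← Finset.sum_add_distrib, hu]
    exact Finset.sum_congr rfl fun _ _ => by ring
  rw [s2, s0, s1, hra, hu]
  have hlr : l * (1 - r) = l - a * l + a := by rw [hr]; field_simp; ring
  simp only [Nat.add_sub_cancel_left]
  rw [pow_two, mul_assoc, hlr]
  have : l - a * l + a ≠ 0 := by
    rw [← hlr]; positivity
  have e : ∀ p q : ℝ, l * ((1 - a) / (l - a * l + a) + a / (l * (l - a * l + a)) * p)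
      + ((1 - a) / (l - a * l + a) * ((a - q * a) / (1 - a))
        + a / (l * (l - a * l + a)) * (a * ((q - p) / (a / l)))) = 1 := by
    intro p q
    have : l * ((1 - a) / (l - a * l + a) + a / (l * (l - a * l + a)) * p)
      + ((1 - a) / (l - a * l + a) * ((a - q * a) / (1 - a))
        + a / (l * (l - a * l + a)) * (a * ((q - p) / (a / l)))) =
        (l - a * l + a) / (l - a * l + a) := by
      field_simp
      ring
    rw [this, div_self ‹_›]
  rw [pow_succ]
  exact e _ _

/-- The remaining inventory is the sum over the trades still to come; reversing time turns it into
an initial sum of length `N + 1 - n`. -/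
lemma one_sub_sum_div_eq {c b r : ℝ} {N n : ℕ} (hn : n ≤ N + 1)
    (h : ∑ k ∈ Finset.range (N + 1), (c + b * r ^ (N - k)) ≠ 0) :
    1 - (∑ k ∈ Finset.range n, (c + b * r ^ (N - k))) /
        ∑ k ∈ Finset.range (N + 1), (c + b * r ^ (N - k)) =
      (∑ k ∈ Finset.range (N + 1 - n), (c + b * r ^ k)) /
        ∑ k ∈ Finset.range (N + 1), (c + b * r ^ k) := by
  have hrefl : ∀ m ≤ N + 1, ∑ k ∈ Finset.Ico (N + 1 - m) (N + 1), (c + b * r ^ (N - k)) =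
      ∑ k ∈ Finset.range m, (c + b * r ^ k) := by
    intro m hm
    rw [Finset.sum_Ico_reflect (fun k => c + b * r ^ k) _ le_rfl, Nat.sub_self,
      Nat.sub_sub_self hm, ← Finset.range_eq_Ico]
  have htot := hrefl (N + 1) le_rfl
  have htail := hrefl (N + 1 - n) (by omega)
  rw [Nat.sub_self, ← Finset.range_eq_Ico] at htot
  rw [Nat.sub_sub_self hn, Finset.sum_Ico_eq_sub _ hn] at htail
  rw [← htail, ← htot, sub_div, div_self h]

lemma sum_range_solution_omega {a l r : ℝ} (hr1 : r ≠ 1) (n : ℕ) :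
    ∑ k ∈ Finset.range n, ((1 - a) / (l * (1 - r)) + a / (l ^ 2 * (1 - r)) * r ^ k) =
      n * (1 - a) / (l * (1 - r)) + a * (1 - r ^ n) / (l * (1 - r)) ^ 2 := by
  have h1r : 1 - r ≠ 0 := sub_ne_zero.mpr hr1.symm
  rw [Finset.sum_add_distrib, ← Finset.mul_sum, geom_sum_eq hr1, Finset.sum_const,
    Finset.card_range, nsmul_eq_mul, ← neg_sub 1 r, ← neg_sub 1 (r ^ n), neg_div_neg_eq]
  field_simp

/-! ### Characteristic roots and their behaviour as `a → 1` -/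

/-- The discriminant of the characteristic polynomial. -/
def charDisc (a d : ℝ) : ℝ := (d + (d - 3) * a ^ 2) ^ 2 + 4 * (d - 1) * (2 - d) * a ^ 2

/-- The characteristic root that tends to `1` as `a → 1`. -/
def upperRoot (a d : ℝ) : ℝ :=
  (d + (d - 3) * a ^ 2 + √(charDisc a d)) / (2 * (d - 1) * a)

/-- The characteristic root that stays away from `1` as `a → 1`. -/
def lowerRoot (a d : ℝ) : ℝ :=
  (d + (d - 3) * a ^ 2 - √(charDisc a d)) / (2 * (d - 1) * a)

lemma upperRoot_quadratic {a d : ℝ} (ha : a ≠ 0) (hd : 1 < d) (h : 0 ≤ charDisc a d) :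
    a * (d - 1) * upperRoot a d ^ 2 - (d + (d - 3) * a ^ 2) * upperRoot a d - (2 - d) * a = 0 := by
  have hs := Real.sq_sqrt h
  have hd' : d - 1 ≠ 0 := by linarith
  rw [upperRoot]
  set s := √(charDisc a d)
  rw [charDisc] at hs
  field_simp
  linear_combination hs

lemma lowerRoot_quadratic {a d : ℝ} (ha : a ≠ 0) (hd : 1 < d) (h : 0 ≤ charDisc a d) :
    a * (d - 1) * lowerRoot a d ^ 2 - (d + (d - 3) * a ^ 2) * lowerRoot a d - (2 - d) * a = 0 := by
  have hs := Real.sq_sqrt h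
  have hd' : d - 1 ≠ 0 := by linarith
  rw [lowerRoot]
  set s := √(charDisc a d)
  rw [charDisc] at hs
  field_simp
  linear_combination hs

lemma charDisc_one (d : ℝ) : charDisc 1 d = 1 := by
  rw [charDisc]; ring

lemma upperRoot_one {d : ℝ} (hd : 1 < d) : upperRoot 1 d = 1 := by
  have hd' : d - 1 ≠ 0 := by linarith
  rw [upperRoot, charDisc_one, Real.sqrt_one]
  field_simp
  ring

lemma lowerRoot_one {d : ℝ} (hd : 1 < d) : lowerRoot 1 d = (d - 2) / (d - 1) := by
  have hd' : d - 1 ≠ 0 := by linarith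
  rw [lowerRoot, charDisc_one, Real.sqrt_one]
  field_simp
  ring

lemma hasDerivAt_charDisc (d : ℝ) :
    HasDerivAt (fun a => charDisc a d) (4 * (5 - 3 * d)) 1 := by
  have h := (((((hasDerivAt_id (1 : ℝ)).pow 2).const_mul (d - 3)).const_add d).pow 2).add
    (((hasDerivAt_id (1 : ℝ)).pow 2).const_mul (4 * (d - 1) * (2 - d)))
  refine HasDerivAt.congr_deriv (f := fun a => charDisc a d) h ?_
  simp
  ring

/-- The slope -3 is the source of the rate 3ρ. It does not depend on `d`, so θ disappears from the
limiting exponentials. -/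
lemma hasDerivAt_upperRoot {d : ℝ} (hd : 1 < d) :
    HasDerivAt (fun a => upperRoot a d) (-3) 1 := by
  have hd' : d - 1 ≠ 0 := by linarith
  have h1 := (((hasDerivAt_id (1 : ℝ)).pow 2).const_mul (d - 3)).const_add d
  have h2 := (hasDerivAt_charDisc d).sqrt (by rw [charDisc_one]; norm_num)
  have h3 := (hasDerivAt_id (1 : ℝ)).const_mul (2 * (d - 1))
  have h := (h1.add h2).div h3 (by simpa using hd')
  refine HasDerivAt.congr_deriv (f := fun a => upperRoot a d) h ?_
  simp [charDisc_one]
  field_simp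
  ring

lemma continuousAt_lowerRoot {d : ℝ} (hd : 1 < d) :
    ContinuousAt (fun a => lowerRoot a d) 1 := by
  have hd' : d - 1 ≠ 0 := by linarith
  unfold lowerRoot
  apply ContinuousAt.div
  · exact (by fun_prop : ContinuousAt (fun a : ℝ => d + (d - 3) * a ^ 2) 1).sub
      (hasDerivAt_charDisc d).continuousAt.sqrt
  · fun_prop
  · simpa using hd'

lemma tendsto_natCast_mul_of_hasDerivAt {F : ℝ → ℝ} {F' : ℝ} (h : HasDerivAt F F' 0) :
    Tendsto (fun N : ℕ => (N : ℝ) * (F (N : ℝ)⁻¹ - F 0)) atTop (𝓝 F') := by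
  have h1 : Tendsto (fun N : ℕ => ((N : ℝ))⁻¹) atTop (𝓝[≠] 0) :=
    (tendsto_inv_atTop_nhdsGT_zero.comp tendsto_natCast_atTop_atTop).mono_right
      (nhdsWithin_mono _ fun x hx => ne_of_gt hx)
  have h2 := h.tendsto_slope_zero.comp h1
  simpa [Function.comp_def] using h2

lemma decay_eq (ρ T : ℝ) (N : ℕ) : decay ρ T N = Real.exp (-(ρ * T) * (N : ℝ)⁻¹) := by
  rw [decay, div_eq_mul_inv]

lemma hasDerivAt_exp_neg_mul (r : ℝ) : HasDerivAt (fun h : ℝ => Real.exp (-r * h)) (-r) 0 := by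
  have := ((hasDerivAt_id (0 : ℝ)).const_mul (-r)).exp
  simpa using this

lemma tendsto_decay (ρ T : ℝ) : Tendsto (fun N : ℕ => decay ρ T N) atTop (𝓝 1) := by
  have h := (hasDerivAt_exp_neg_mul (ρ * T)).continuousAt.tendsto.comp
    (tendsto_inv_atTop_zero.comp (tendsto_natCast_atTop_atTop (R := ℝ)))
  simpa [Function.comp_def, decay_eq] using h

lemma tendsto_mul_one_sub_decay (ρ T : ℝ) :
    Tendsto (fun N : ℕ => (N : ℝ) * (1 - decay ρ T N)) atTop (𝓝 (ρ * T)) := by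
  have h := (tendsto_natCast_mul_of_hasDerivAt (hasDerivAt_exp_neg_mul (ρ * T))).neg
  simp only [neg_neg] at h
  refine h.congr fun N => ?_
  simp [decay_eq]
  ring

lemma hasDerivAt_upperRoot_exp (r : ℝ) {d : ℝ} (hd : 1 < d) :
    HasDerivAt (fun h : ℝ => upperRoot (Real.exp (-r * h)) d) (3 * r) 0 := by
  have h1 : HasDerivAt (fun a => upperRoot a d) (-3) (Real.exp (-r * 0)) := by
    simpa using hasDerivAt_upperRoot hd
  have h2 := h1.comp 0 (hasDerivAt_exp_neg_mul r)
  exact h2.congr_deriv (by ring)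

lemma tendsto_mul_upperRoot_sub_one (ρ T : ℝ) {d : ℝ} (hd : 1 < d) :
    Tendsto (fun N : ℕ => (N : ℝ) * (upperRoot (decay ρ T N) d - 1)) atTop (𝓝 (3 * (ρ * T))) := by
  have h := tendsto_natCast_mul_of_hasDerivAt (hasDerivAt_upperRoot_exp (ρ * T) hd)
  simpa [decay_eq, upperRoot_one hd] using h

lemma tendsto_upperRoot (ρ T : ℝ) {d : ℝ} (hd : 1 < d) :
    Tendsto (fun N : ℕ => upperRoot (decay ρ T N) d) atTop (𝓝 1) := by
  have h := (hasDerivAt_upperRoot hd).continuousAt.tendsto.comp (tendsto_decay ρ T)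
  simpa [Function.comp_def, upperRoot_one hd] using h

lemma tendsto_lowerRoot (ρ T : ℝ) {d : ℝ} (hd : 1 < d) :
    Tendsto (fun N : ℕ => lowerRoot (decay ρ T N) d) atTop (𝓝 ((d - 2) / (d - 1))) := by
  have h := (continuousAt_lowerRoot hd).tendsto.comp (tendsto_decay ρ T)
  simpa [Function.comp_def, lowerRoot_one hd] using h

lemma eventually_charDisc_nonneg (ρ T d : ℝ) :
    ∀ᶠ N : ℕ in atTop, 0 ≤ charDisc (decay ρ T N) d := by
  have h := (hasDerivAt_charDisc d).continuousAt.tendsto.comp (tendsto_decay ρ T)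
  rw [charDisc_one] at h
  exact (h.eventually (lt_mem_nhds one_pos)).mono fun _ h => h.le

lemma tendsto_mul_log_upperRoot (ρ T : ℝ) {d : ℝ} (hd : 1 < d) :
    Tendsto (fun N : ℕ => (N : ℝ) * Real.log (upperRoot (decay ρ T N) d)) atTop
      (𝓝 (3 * (ρ * T))) := by
  have h := tendsto_natCast_mul_of_hasDerivAt ((hasDerivAt_upperRoot_exp (ρ * T) hd).log
    (by simp [upperRoot_one hd]))
  simpa [decay_eq, upperRoot_one hd] using h

/-- Write the power as exp((m/K) · K log x), where K log x → 3ρT. The filter is arbitrary so that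
subsequences of fixed parity are covered. -/
lemma tendsto_upperRoot_pow {ι : Type*} {l : Filter ι} {K m : ι → ℕ} {τ : ℝ} (ρ T : ℝ) {d : ℝ}
    (hd : 1 < d) (hK : Tendsto K l atTop)
    (hm : Tendsto (fun i => (m i : ℝ) / K i) l (𝓝 τ)) :
    Tendsto (fun i => upperRoot (decay ρ T (K i)) d ^ m i) l
      (𝓝 (Real.exp (3 * (ρ * T) * τ))) := by
  have h := ((((tendsto_mul_log_upperRoot ρ T hd).comp hK).mul hm).rexp)
  refine h.congr' ?_
  filter_upwards [hK.eventually ((tendsto_upperRoot ρ T hd).eventually (lt_mem_nhds one_pos)),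
    hK.eventually (eventually_ge_atTop 1)] with i hx hi
  have hi' : (K i : ℝ) ≠ 0 := by
    have : K i ≠ 0 := by omega
    exact_mod_cast this
  rw [← Real.exp_log (pow_pos hx _), Real.log_pow]
  congr 1
  simp only [Function.comp_apply]
  field_simp

lemma tendsto_pow_zero_of_tendsto {ι : Type*} {l : Filter ι} {y : ι → ℝ} {Y : ℝ} {m : ι → ℕ}
    (hy : Tendsto y l (𝓝 Y)) (hY : |Y| < 1) (hm : Tendsto m l atTop) :
    Tendsto (fun i => y i ^ m i) l (𝓝 0) := by
  obtain ⟨q, hq1, hq2⟩ := exists_between hY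
  have hq0 : 0 ≤ q := (abs_nonneg Y).trans hq1.le
  apply squeeze_zero_norm' _ ((tendsto_pow_atTop_nhds_zero_of_lt_one hq0 hq2).comp hm)
  filter_upwards [hy.abs.eventually (gt_mem_nhds hq1)] with i hi
  rw [Real.norm_eq_abs, abs_pow]
  exact pow_le_pow_left₀ (abs_nonneg _) hi.le _

/-- The product of the roots is -(2 - d)/(d - 1), which is -1 at `d = 3 / 2`, the case θ = 0. -/
lemma lowerRoot_three_halves {a : ℝ} (ha : 0 < a) :
    lowerRoot a (3 / 2) = -(upperRoot a (3 / 2))⁻¹ := by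
  have hdisc : charDisc a (3 / 2) = (3 / 2 * (1 - a ^ 2)) ^ 2 + a ^ 2 := by
    rw [charDisc]; ring
  have h0 : 0 < charDisc a (3 / 2) := by rw [hdisc]; positivity
  have hs := Real.sq_sqrt h0.le
  have hlt : 3 / 2 * (a ^ 2 - 1) < √(charDisc a (3 / 2)) := by
    apply Real.lt_sqrt_of_sq_lt
    rw [hdisc]
    nlinarith [pow_pos ha 2]
  rw [hdisc] at hs
  rw [lowerRoot, upperRoot]
  rw [hdisc] at hlt ⊢
  set s := √((3 / 2 * (1 - a ^ 2)) ^ 2 + a ^ 2)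
  have h1 : 3 / 2 + (3 / 2 - 3) * a ^ 2 + s ≠ 0 := by linarith
  have h2 : (2 * (3 / 2 - 1) * a : ℝ) ≠ 0 := by positivity
  rw [inv_div, ← neg_div, div_eq_div_iff h2 h1]
  linear_combination -hs

lemma tendsto_numTrades_div {T t : ℝ} (hT : 0 < T) (ht : 0 ≤ t) :
    Tendsto (fun N : ℕ => (numTrades T N t : ℝ) / N) atTop (𝓝 (t / T)) := by
  have h := (tendsto_nat_ceil_mul_div_atTop (div_nonneg ht hT.le)).comp
    (tendsto_natCast_atTop_atTop (R := ℝ))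
  refine h.congr fun N => ?_
  simp only [Function.comp_apply, numTrades]
  congr 3
  ring

lemma tendsto_succ_div {ι : Type*} {l : Filter ι} {K : ι → ℕ} (hK : Tendsto K l atTop) :
    Tendsto (fun i => ((K i + 1 : ℕ) : ℝ) / K i) l (𝓝 1) := by
  have h : Tendsto (fun N : ℕ => 1 + 1 / (N : ℝ)) atTop (𝓝 (1 + 0)) :=
    tendsto_const_nhds.add tendsto_one_div_atTop_nhds_zero_nat
  rw [add_zero] at h
  refine (h.comp hK).congr' ?_
  filter_upwards [hK.eventually (eventually_ge_atTop 1)] with i hi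
  have hi' : (K i : ℝ) ≠ 0 := by
    have : K i ≠ 0 := by omega
    exact_mod_cast this
  simp only [Function.comp_apply]
  push_cast
  field_simp

/-! ### Limit of `V` along a general filter -/

/-- The limit of the rescaled partial sums of `ν`, where `r = ρT`, `E = e^{3ρT}`, `η` and `ζ` are
the limits of the powers `N + 1` and `n` of the second characteristic root, `e` is the limit of
the `n`-th power of the first one, and `τ` is the limit of `n / N`. -/
def nuLimit (r E η τ e ζ : ℝ) : ℝ :=
  τ * r + 4 * (1 + η) / (2 * E - η) * (1 / 3 * (e - 1)) + (2 * E + 1) / (2 * E - η) * (1 - ζ)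

lemma nuLimit_total_pos {r E η : ℝ} (hr : 0 < r) (hE : 1 < E) (hη : |η| < 1) :
    0 < nuLimit r E η 1 E η := by
  obtain ⟨h1, h2⟩ := abs_lt.mp hη
  have h3 : 0 < 2 * E - η := by linarith
  have h4 : 0 < 1 + η := by linarith
  have h5 : 0 < 1 - η := by linarith
  have h6 : 0 < E - 1 := by linarith
  have h7 : 0 < 2 * E + 1 := by linarith
  rw [nuLimit]
  positivity

lemma cramer_two {p₁ p₂ q₁ q₂ : ℝ} (h : p₁ * q₂ - p₂ * q₁ ≠ 0) :
    1 + (q₁ - q₂) / (p₁ * q₂ - p₂ * q₁) * p₁ + (p₂ - p₁) / (p₁ * q₂ - p₂ * q₁) * q₁ = 0 ∧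
      1 + (q₁ - q₂) / (p₁ * q₂ - p₂ * q₁) * p₂ + (p₂ - p₁) / (p₁ * q₂ - p₂ * q₁) * q₂ = 0 := by
  constructor <;>
  · rw [← div_self h, div_mul_eq_mul_div, div_mul_eq_mul_div, ← add_div, ← add_div, div_eq_zero_iff]
    left
    ring

lemma tendsto_V {ι : Type*} {l : Filter ι} {K : ι → ℕ} {ρ T θ t η ζ : ℝ} (hρ : 0 < ρ)
    (hT : 0 < T) (hθ : 0 ≤ θ) (ht0 : 0 ≤ t) (ht : t ≤ T) (hK : Tendsto K l atTop)
    (hη : Tendsto (fun i => lowerRoot (decay ρ T (K i)) (3 / 2 + 2 * θ) ^ (K i + 1)) l (𝓝 η))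
    (hζ : Tendsto (fun i => lowerRoot (decay ρ T (K i)) (3 / 2 + 2 * θ) ^ numTrades T (K i) t)
      l (𝓝 ζ)) (hη1 : |η| < 1) :
    Tendsto (fun i => V ρ T θ (K i) t) l
      (𝓝 (1 - nuLimit (ρ * T) (Real.exp (3 * ρ * T)) η (t / T) (Real.exp (3 * ρ * t)) ζ /
        nuLimit (ρ * T) (Real.exp (3 * ρ * T)) η 1 (Real.exp (3 * ρ * T)) η)) := by
  set d : ℝ := 3 / 2 + 2 * θ with hd_def
  have hd : 1 < d := by linarith
  have hr : 0 < ρ * T := mul_pos hρ hT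
  set E := Real.exp (3 * ρ * T) with hE_def
  have hE1 : 1 < E := Real.one_lt_exp_iff.mpr (by positivity)
  set a : ι → ℝ := fun i => decay ρ T (K i) with ha_def
  set x : ι → ℝ := fun i => upperRoot (a i) d with hx_def
  set y : ι → ℝ := fun i => lowerRoot (a i) d with hy_def
  set Y := (d - 2) / (d - 1) with hY_def
  set m : ι → ℕ := fun i => numTrades T (K i) t with hm_def
  have hY1 : Y < 1 := by rw [hY_def, div_lt_one (by linarith)]; linarith
  have hY1' : 1 - Y ≠ 0 := by linarith
  have hY1'' : Y - 1 ≠ 0 := by linarith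
  have la : Tendsto a l (𝓝 1) := (tendsto_decay ρ T).comp hK
  have ly : Tendsto y l (𝓝 Y) := (tendsto_lowerRoot ρ T hd).comp hK
  have lKa : Tendsto (fun i => (K i : ℝ) * (1 - a i)) l (𝓝 (ρ * T)) :=
    (tendsto_mul_one_sub_decay ρ T).comp hK
  have lKx : Tendsto (fun i => (K i : ℝ) * (x i - 1)) l (𝓝 (3 * (ρ * T))) :=
    (tendsto_mul_upperRoot_sub_one ρ T hd).comp hK
  have lm : Tendsto (fun i => (m i : ℝ) / K i) l (𝓝 (t / T)) :=
    (tendsto_numTrades_div hT ht0).comp hK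
  have lK1 := tendsto_succ_div hK
  have lxm : Tendsto (fun i => x i ^ m i) l (𝓝 (Real.exp (3 * ρ * t))) := by
    have := tendsto_upperRoot_pow ρ T hd hK lm
    rwa [show 3 * (ρ * T) * (t / T) = 3 * ρ * t by field_simp] at this
  have lxK : Tendsto (fun i => x i ^ (K i + 1)) l (𝓝 E) := by
    have := tendsto_upperRoot_pow ρ T hd hK lK1
    rwa [show 3 * (ρ * T) * 1 = 3 * ρ * T by ring] at this
  have hKpos : ∀ᶠ i in l, (0 : ℝ) < K i := by
    filter_upwards [hK.eventually (eventually_ge_atTop 1)] with i hi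
    exact_mod_cast hi
  -- ratios of quantities of order `1 / K`
  have lp : Tendsto (fun i => (1 - a i) / (x i - a i)) l (𝓝 (1 / 4)) := by
    have h := lKa.div (lKx.add lKa) (by linarith)
    rw [show ρ * T / (3 * (ρ * T) + ρ * T) = 1 / 4 by field_simp; norm_num] at h
    refine h.congr' ?_
    filter_upwards [hKpos] with i hi
    simp only [Pi.div_apply]
    rw [← mul_add, mul_div_mul_left _ _ hi.ne']
    congr 1
    ring
  have lp2 : Tendsto (fun i => (1 - a i) / (1 - a i * x i)) l (𝓝 (-1 / 2)) := by
    have h := lKa.div (lKa.sub (la.mul lKx)) (by linarith)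
    rw [show ρ * T / (ρ * T - 1 * (3 * (ρ * T))) = -1 / 2 by
      rw [div_eq_div_iff (by linarith) (by norm_num)]; ring] at h
    refine h.congr' ?_
    filter_upwards [hKpos] with i hi
    simp only [Pi.div_apply]
    rw [mul_left_comm, ← mul_sub, mul_div_mul_left _ _ hi.ne']
    congr 1
    ring
  have lp3 : Tendsto (fun i => (1 - a i) / (x i - 1)) l (𝓝 (1 / 3)) := by
    have h := lKa.div lKx (by linarith)
    rw [show ρ * T / (3 * (ρ * T)) = 1 / 3 by field_simp] at h
    refine h.congr' ?_
    filter_upwards [hKpos] with i hi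
    simp only [Pi.div_apply]
    rw [mul_div_mul_left _ _ hi.ne']
  have lq : Tendsto (fun i => 1 / (y i - a i)) l (𝓝 (1 / (Y - 1))) :=
    tendsto_const_nhds.div (ly.sub la) hY1''
  have lq2 : Tendsto (fun i => y i ^ (K i + 1) / (1 - a i * y i)) l (𝓝 (η / (1 - 1 * Y))) :=
    hη.div (tendsto_const_nhds.sub (la.mul ly)) (by rwa [one_mul])
  set p₁ : ι → ℝ := fun i => (1 - a i) / (x i - a i) with hp₁
  set p₂ : ι → ℝ := fun i => (1 - a i) / (1 - a i * x i) * x i ^ (K i + 1) with hp₂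
  set q₁ : ι → ℝ := fun i => 1 / (y i - a i) with hq₁
  set q₂ : ι → ℝ := fun i => y i ^ (K i + 1) / (1 - a i * y i) with hq₂
  have lp₂ : Tendsto p₂ l (𝓝 (-1 / 2 * E)) := lp2.mul lxK
  have lD := (lp.mul lq2).sub (lp₂.mul lq)
  -- This is, up to a nonzero factor, the limiting determinant of the two boundary conditions, so
  -- `α` and `B` have limits by Cramer's rule.
  have hEη : 2 * E - η ≠ 0 := by have := (abs_lt.mp hη1).2; linarith
  have hD : 1 / 4 * (η / (1 - 1 * Y)) - -1 / 2 * E * (1 / (Y - 1)) =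
      -(2 * E - η) / (4 * (1 - Y)) := by
    rw [← neg_sub 1 Y]
    field_simp
    ring
  rw [hD] at lD
  have hD0 : -(2 * E - η) / (4 * (1 - Y)) ≠ 0 :=
    div_ne_zero (neg_ne_zero.mpr hEη) (mul_ne_zero four_ne_zero hY1')
  have lα := (lq.sub lq2).div lD hD0
  have lB := (lp₂.sub lp).div lD hD0
  rw [show (1 / (Y - 1) - η / (1 - 1 * Y)) / (-(2 * E - η) / (4 * (1 - Y))) =
      4 * (1 + η) / (2 * E - η) by
    rw [← neg_sub 1 Y]
    field_simp
    ring] at lα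
  rw [show (-1 / 2 * E - 1 / 4) / (-(2 * E - η) / (4 * (1 - Y))) =
      (1 - Y) * ((2 * E + 1) / (2 * E - η)) by
    field_simp
    ring] at lB
  set α : ι → ℝ := (fun i => q₁ i - q₂ i) / fun i => p₁ i * q₂ i - p₂ i * q₁ i with hα
  set B : ι → ℝ := (fun i => p₂ i - p₁ i) / fun i => p₁ i * q₂ i - p₂ i * q₁ i with hB
  -- the rescaled partial sums
  set F : ι → ℕ → ℝ := fun i n => n * (1 - a i) + α i * ((1 - a i) / (x i - 1) * (x i ^ n - 1))
      + B i * ((1 - y i ^ n) / (1 - y i)) with hF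
  have lF : ∀ (n : ι → ℕ) (τ e z : ℝ), Tendsto (fun i => (n i : ℝ) / K i) l (𝓝 τ) →
      Tendsto (fun i => x i ^ n i) l (𝓝 e) → Tendsto (fun i => y i ^ n i) l (𝓝 z) →
      Tendsto (fun i => F i (n i)) l (𝓝 (nuLimit (ρ * T) E η τ e z)) := by
    intro n τ e z h1 h2 h3
    have h4 := ((h1.mul lKa).add (lα.mul (lp3.mul (h2.sub_const 1)))).add
      (lB.mul ((h3.const_sub 1).div (tendsto_const_nhds.sub ly) hY1'))
    rw [show (τ * (ρ * T) + 4 * (1 + η) / (2 * E - η) * (1 / 3 * (e - 1))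
      + (1 - Y) * ((2 * E + 1) / (2 * E - η)) * ((1 - z) / (1 - Y))) =
      nuLimit (ρ * T) E η τ e z by rw [nuLimit]; field_simp] at h4
    refine h4.congr' ?_
    filter_upwards [hKpos] with i hi
    simp only [hF, Pi.div_apply]
    congr 2
    field_simp
  have lnum := lF m _ _ _ lm lxm hζ
  have lden := lF (fun i => K i + 1) _ _ _ lK1 lxK hη
  have hpos := nuLimit_total_pos hr hE1 hη1
  refine (tendsto_const_nhds.sub (lnum.div lden hpos.ne')).congr' ?_
  -- The explicit solution is needed only eventually: real roots, a nonzero determinant and roots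
  -- different from 1 all follow from the limits above.
  filter_upwards [hK.eventually (eventually_ge_atTop 1),
    hK.eventually (eventually_charDisc_nonneg ρ T d), lD.eventually_ne hD0,
    ly.eventually_ne hY1.ne, lKx.eventually_ne (by positivity : 3 * (ρ * T) ≠ 0)]
    with i hi hdisc hDi hyi hxi
  have ha0 : 0 < a i := decay_pos _ _ _
  have ha1 : a i < 1 := decay_lt_one hρ hT hi
  have hx1 : x i ≠ 1 := by
    intro h
    rw [h] at hxi
    simp at hxi
  obtain ⟨hxa, hax, hxc⟩ := characteristic_root ha0 ha1 (upperRoot_quadratic ha0.ne' hd hdisc)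
  obtain ⟨hya, hay, hyc⟩ := characteristic_root ha0 ha1 (lowerRoot_quadratic ha0.ne' hd hdisc)
  have hden : 0 < d * (1 - a i) + 3 * a i := by
    have := mul_pos (by linarith : 0 < d) (sub_pos.mpr ha1)
    linarith
  obtain ⟨hleft, hright⟩ := cramer_two hDi
  have hnu := nu_eq_of_forall hρ hT hθ hi
    (fun k => (1 - a i) / (d * (1 - a i) + 3 * a i) *
      (1 + α i * x i ^ k + B i / (1 - a i) * y i ^ k))
    (fun k hk => kernel_apply_solution ha1.ne hden.ne' hxa hax hya hay hxc hyc hleft hright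
      hk _ rfl)
  -- The prefactor common to both partial sums cancels, leaving the ratio of values of `F`.
  rw [V_eq_of_nu_eq hT ht (u := fun k => (1 - a i) / (d * (1 - a i) + 3 * a i) *
      (1 + α i * x i ^ k + B i / (1 - a i) * y i ^ k)) hnu,
    sum_range_solution ha1.ne hx1 hyi, sum_range_solution ha1.ne hx1 hyi,
    mul_div_mul_left _ _ (one_div_ne_zero hden.ne')]
  rfl

/-! ### Limit of `W` along a general filter -/

lemma tendsto_decay_pow {ι : Type*} {l : Filter ι} {K m : ι → ℕ} {τ : ℝ} (ρ T : ℝ)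
    (hm : Tendsto (fun i => (m i : ℝ) / K i) l (𝓝 τ)) :
    Tendsto (fun i => decay ρ T (K i) ^ m i) l (𝓝 (Real.exp (-(ρ * T) * τ))) := by
  refine (hm.const_mul (-(ρ * T))).rexp.congr fun i => ?_
  rw [decay, ← Real.exp_nat_mul]
  congr 1
  ring

lemma tendsto_remaining_div {ι : Type*} {l : Filter ι} {K : ι → ℕ} {T t : ℝ} (hT : 0 < T)
    (ht0 : 0 ≤ t) (ht : t ≤ T) (hK : Tendsto K l atTop) :
    Tendsto (fun i => ((K i + 1 - numTrades T (K i) t : ℕ) : ℝ) / K i) l (𝓝 (1 - t / T)) := by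
  refine ((tendsto_succ_div hK).sub ((tendsto_numTrades_div hT ht0).comp hK)).congr fun i => ?_
  have := numTrades_le hT (K i) ht
  rw [Function.comp_apply, Nat.cast_sub (by omega), sub_div]

lemma tendsto_W {ι : Type*} {l : Filter ι} {K : ι → ℕ} {ρ T θ t η ζ : ℝ} (hρ : 0 < ρ)
    (hT : 0 < T) (hθ : 0 ≤ θ) (ht0 : 0 ≤ t) (ht : t ≤ T) (hK : Tendsto K l atTop)
    (hη : Tendsto (fun i => (decay ρ T (K i) * (1 - 1 / (1 / 2 + 2 * θ))) ^ (K i + 1)) l (𝓝 η))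
    (hζ : Tendsto (fun i => (decay ρ T (K i) * (1 - 1 / (1 / 2 + 2 * θ))) ^
      (K i + 1 - numTrades T (K i) t)) l (𝓝 ζ)) (hη1 : ρ * T + (1 - η) ≠ 0) :
    Tendsto (fun i => W ρ T θ (K i) t) l
      (𝓝 ((ρ * (T - t) + (1 - ζ)) / (ρ * T + (1 - η)))) := by
  set b : ℝ := 1 / 2 + 2 * θ with hb_def
  have hb : 0 < b := by linarith
  set a : ι → ℝ := fun i => decay ρ T (K i) with ha_def
  set r : ι → ℝ := fun i => a i * (1 - 1 / b) with hr_def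
  have la : Tendsto a l (𝓝 1) := (tendsto_decay ρ T).comp hK
  have lKa : Tendsto (fun i => (K i : ℝ) * (1 - a i)) l (𝓝 (ρ * T)) :=
    (tendsto_mul_one_sub_decay ρ T).comp hK
  have lbr : Tendsto (fun i => b * (1 - r i)) l (𝓝 1) := by
    have h := ((la.mul_const (1 - 1 / b)).const_sub 1).const_mul b
    rwa [show b * (1 - 1 * (1 - 1 / b)) = 1 by field_simp; ring] at h
  have hKpos : ∀ᶠ i in l, (0 : ℝ) < K i := by
    filter_upwards [hK.eventually (eventually_ge_atTop 1)] with i hi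
    exact_mod_cast hi
  set F : ι → ℕ → ℝ := fun i n => n * (1 - a i) / (b * (1 - r i))
    + a i * (1 - r i ^ n) / (b * (1 - r i)) ^ 2 with hF
  have lF : ∀ (n : ι → ℕ) (τ z : ℝ), Tendsto (fun i => (n i : ℝ) / K i) l (𝓝 τ) →
      Tendsto (fun i => r i ^ n i) l (𝓝 z) →
      Tendsto (fun i => F i (n i)) l (𝓝 (τ * (ρ * T) + (1 - z))) := by
    intro n τ z h1 h2
    have h3 := ((h1.mul lKa).div lbr one_ne_zero).add
      ((la.mul (h2.const_sub 1)).div (lbr.pow 2) (by norm_num))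
    rw [show τ * (ρ * T) / 1 + 1 * (1 - z) / 1 ^ 2 = τ * (ρ * T) + (1 - z) by ring] at h3
    refine h3.congr' ?_
    filter_upwards [hKpos] with i hi
    simp only [hF, Pi.div_apply]
    congr 2
    field_simp
  have lnum := lF _ _ _ (tendsto_remaining_div hT ht0 ht hK) hζ
  have lden := lF _ _ _ (tendsto_succ_div hK) hη
  rw [show (1 - t / T) * (ρ * T) = ρ * (T - t) by field_simp] at lnum
  rw [one_mul] at lden
  refine (lnum.div lden hη1).congr' ?_
  filter_upwards [hK.eventually (eventually_ge_atTop 1)] with i hi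
  have ha0 : 0 < a i := decay_pos _ _ _
  have ha1 : a i < 1 := decay_lt_one hρ hT hi
  have hr1 : r i ≠ 1 := by
    have h1 : 0 < a i * (1 / b) := mul_pos ha0 (one_div_pos.mpr hb)
    have h2 : r i = a i - a i * (1 / b) := by rw [hr_def]; ring
    linarith
  have hom := omega_eq_of_forall hρ hT hθ hi
    (fun k => (1 - a i) / (b * (1 - r i)) + a i / (b ^ 2 * (1 - r i)) * r i ^ (K i - k))
    (fun k hk => kernel_apply_solution_omega ha0 ha1 hb rfl hr1 hk _ rfl)
  have hsum := sum_omega_pos hρ hT hθ hi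
  rw [hom, Fin.sum_univ_eq_sum_range (fun k => (1 - a i) / (b * (1 - r i))
    + a i / (b ^ 2 * (1 - r i)) * r i ^ (K i - k))] at hsum
  have hle := numTrades_le hT (K i) ht
  rw [W_eq_of_omega_eq hT ht (u := fun k => (1 - a i) / (b * (1 - r i))
    + a i / (b ^ 2 * (1 - r i)) * r i ^ (K i - k)) hom,
    one_sub_sum_div_eq (by omega) hsum.ne', sum_range_solution_omega hr1,
    sum_range_solution_omega hr1]
  rfl

/-! ### Recurrence of both parities, and cluster points -/

/-- Increments lie strictly between σ - 1 and σ + 1. If the parity were eventually constant, they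
would all be 0 (when σ ≤ 1) or all be 2 (when σ > 1), and `n` would leave the unit-width strip
around a line of slope σ in (0, 2). -/
lemma exists_parity_change_of_linear_growth {n : ℕ → ℕ} {σ c : ℝ} (h0 : 0 < σ) (h2 : σ < 2)
    (hl : ∀ i : ℕ, σ * i + c ≤ n i) (hu : ∀ i : ℕ, (n i : ℝ) < σ * i + c + 1) (M : ℕ) :
    ∃ i ≥ M, ¬ (Even (n (i + 1)) ↔ Even (n i)) := by
  by_contra! hM
  have hdl : ∀ i, (n i : ℝ) + σ - 1 < n (i + 1) := by
    intro i
    have := hl (i + 1)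
    push_cast at this
    linarith [hu i]
  have hdu : ∀ i, (n (i + 1) : ℝ) < n i + σ + 1 := by
    intro i
    have := hu (i + 1)
    push_cast at this
    linarith [hl i]
  rcases le_or_gt σ 1 with hσ | hσ
  · have hstep : ∀ i ≥ M, n (i + 1) = n i := by
      intro i hi
      have h3 : n (i + 1) < n i + 2 := by
        have : (n (i + 1) : ℝ) < n i + 2 := by linarith [hdu i]
        exact_mod_cast this
      have h4 : n i < n (i + 1) + 1 := by
        have : (n i : ℝ) < n (i + 1) + 1 := by linarith [hdl i]
        exact_mod_cast this
      have h5 := hM i hi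
      rcases (by omega : n (i + 1) = n i ∨ n (i + 1) = n i + 1) with h | h
      · exact h
      · rw [h, Nat.even_add_one] at h5
        tauto
    have hconst : ∀ k, n (M + k) = n M := by
      intro k
      induction k with
      | zero => rfl
      | succ k ih => rw [← add_assoc, hstep _ (by omega), ih]
    -- After more than 1/σ steps the line rises by more than the width of the strip. In the other
    -- case the gap opens at rate 2 - σ.
    obtain ⟨k, hk⟩ := exists_nat_gt (1 / σ)
    rw [div_lt_iff₀ h0] at hk
    have h6 := hl (M + k)
    rw [hconst k] at h6
    push_cast at h6
    nlinarith [hu M]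
  · have hstep : ∀ i ≥ M, n (i + 1) = n i + 2 := by
      intro i hi
      have h3 : n (i + 1) < n i + 3 := by
        have : (n (i + 1) : ℝ) < n i + 3 := by linarith [hdu i]
        exact_mod_cast this
      have h4 : n i < n (i + 1) := by
        have : (n i : ℝ) < n (i + 1) := by linarith [hdl i]
        exact_mod_cast this
      have h5 := hM i hi
      rcases (by omega : n (i + 1) = n i + 2 ∨ n (i + 1) = n i + 1) with h | h
      · exact h
      · rw [h, Nat.even_add_one] at h5
        tauto
    have hlin : ∀ k, n (M + k) = n M + 2 * k := by
      intro k
      induction k with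
      | zero => rfl
      | succ k ih => rw [← add_assoc, hstep _ (by omega), ih]; ring
    obtain ⟨k, hk⟩ := exists_nat_gt (1 / (2 - σ))
    rw [div_lt_iff₀ (by linarith)] at hk
    have h6 := hu (M + k)
    rw [hlin k] at h6
    push_cast at h6
    nlinarith [hl M]

lemma frequently_parity_numTrades {T t : ℝ} (hT : 0 < T) (ht0 : 0 < t) (ht : t < T) (j : ℕ) :
    (∃ᶠ i : ℕ in atTop, Even (numTrades T (2 * i + j) t)) ∧
      ∃ᶠ i : ℕ in atTop, ¬ Even (numTrades T (2 * i + j) t) := by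
  have hpos : 0 < t / T := div_pos ht0 hT
  have hlt : t / T < 1 := (div_lt_one hT).mpr ht
  have key := exists_parity_change_of_linear_growth
    (n := fun i => numTrades T (2 * i + j) t) (σ := 2 * (t / T)) (c := j * (t / T))
    (by linarith) (by linarith)
    (fun i => by
      refine le_trans (le_of_eq ?_) (Nat.le_ceil _)
      push_cast
      ring)
    (fun i => by
      have h := Nat.ceil_lt_add_one (a := ((2 * i + j : ℕ) : ℝ) * t / T) (by positivity)
      refine lt_of_lt_of_eq h ?_
      push_cast
      ring)
  simp only [Filter.Frequently, not_not]
  constructor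
  · intro h
    obtain ⟨M, hM⟩ := eventually_atTop.mp h
    obtain ⟨i, hi, hne⟩ := key M
    exact hne (iff_of_false (hM (i + 1) (by omega)) (hM i hi))
  · intro h
    obtain ⟨M, hM⟩ := eventually_atTop.mp h
    obtain ⟨i, hi, hne⟩ := key M
    exact hne (iff_of_true (hM (i + 1) (by omega)) (hM i hi))

/-- `atTop` is the supremum of its restrictions to `p` and to its negation, and a cluster point
along a supremum is one along a summand. Both restrictions are nontrivial, and along each the limit
is the only cluster point. -/
lemma exactlyTwoClusterPoints_of_tendsto {u : ℕ → ℝ} {p : ℕ → Prop} {a b : ℝ} (hab : a ≠ b)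
    (hp : ∃ᶠ i in atTop, p i) (hn : ∃ᶠ i in atTop, ¬ p i)
    (ha : Tendsto u (atTop ⊓ 𝓟 {i | p i}) (𝓝 a))
    (hb : Tendsto u (atTop ⊓ 𝓟 {i | ¬ p i}) (𝓝 b)) : ExactlyTwoClusterPoints u a b := by
  have : NeBot (atTop ⊓ 𝓟 {i | p i}) := frequently_mem_iff_neBot.mp hp
  have : NeBot (atTop ⊓ 𝓟 {i | ¬ p i}) := frequently_mem_iff_neBot.mp hn
  refine ⟨hab, Set.ext fun x => ⟨fun hx => ?_, ?_⟩⟩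
  · have hsplit : (atTop : Filter ℕ) = atTop ⊓ 𝓟 {i | p i} ⊔ atTop ⊓ 𝓟 {i | ¬ p i} := by
      rw [← inf_sup_left, sup_principal, show {i | p i} ∪ {i | ¬ p i} = Set.univ from
        Set.union_compl_self _, principal_univ, inf_top_eq]
    have hx' : MapClusterPt x atTop u := hx
    rw [hsplit, mapClusterPt_def, map_sup, clusterPt_sup] at hx'
    rcases hx' with h | h
    · left
      exact eq_of_nhds_neBot (ClusterPt.mono h ha)
    · right
      exact eq_of_nhds_neBot (ClusterPt.mono h hb)
  · rintro (rfl | rfl)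
    · exact ha.mapClusterPt.mono inf_le_left
    · exact hb.mapClusterPt.mono inf_le_left

lemma tendsto_atTop_of_tendsto_div {ι : Type*} {l : Filter ι} {K m : ι → ℕ} {τ : ℝ} (hτ : 0 < τ)
    (hK : Tendsto K l atTop) (hm : Tendsto (fun i => (m i : ℝ) / K i) l (𝓝 τ)) :
    Tendsto m l atTop := by
  have hK' : Tendsto (fun i => (K i : ℝ)) l atTop := tendsto_natCast_atTop_atTop.comp hK
  rw [← tendsto_natCast_atTop_iff (R := ℝ)]
  refine (hm.pos_mul_atTop hτ hK').congr' ?_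
  filter_upwards [hK'.eventually (eventually_gt_atTop 0)] with i hi
  field_simp

/-! ### The limits of `V` for θ > 0 and θ = 0 -/

lemma tendsto_V_of_pos {ρ T θ t : ℝ} (hρ : 0 < ρ) (hT : 0 < T) (hθ : 0 < θ) (ht0 : 0 < t)
    (ht : t ≤ T) : Tendsto (fun N : ℕ => V ρ T θ N t) atTop (𝓝 (VLimit ρ T t)) := by
  have hd : 1 < 3 / 2 + 2 * θ := by linarith
  have hY : |(3 / 2 + 2 * θ - 2) / (3 / 2 + 2 * θ - 1)| < 1 := by
    have h : 0 < 3 / 2 + 2 * θ - 1 := by linarith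
    rw [abs_lt, lt_div_iff₀ h, div_lt_one h]
    constructor <;> linarith
  have hlr := tendsto_lowerRoot ρ T hd
  have h : Tendsto (fun N : ℕ => V ρ T θ N t) atTop (𝓝 _) :=
    tendsto_V hρ hT hθ.le ht0.le ht tendsto_id
    (tendsto_pow_zero_of_tendsto hlr hY (tendsto_add_atTop_nat 1))
    -- Here t > 0 is essential: n_t must tend to infinity for this power to vanish.
    (tendsto_pow_zero_of_tendsto hlr hY (tendsto_atTop_of_tendsto_div (div_pos ht0 hT) tendsto_id
      (tendsto_numTrades_div hT ht0.le))) (by simp)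
  convert h using 2
  have hE : 1 < Real.exp (3 * ρ * T) := Real.one_lt_exp_iff.mpr (by positivity)
  rw [VLimit]
  set E := Real.exp (3 * ρ * T)
  set e := Real.exp (3 * ρ * t)
  have hE0 : 0 < E := by linarith
  have hden : 0 < 2 * E * (3 * ρ * T + 5) - 1 := by
    have : 0 < E * (ρ * T) := by positivity
    nlinarith
  have h1 : nuLimit (ρ * T) E 0 (t / T) e 0 =
      (6 * E * (ρ * t) + 4 * (e - 1) + 6 * E + 3) / (6 * E) := by
    rw [nuLimit]
    field_simp
    ring
  have h2 : nuLimit (ρ * T) E 0 1 E 0 = (2 * E * (3 * ρ * T + 5) - 1) / (6 * E) := by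
    rw [nuLimit]
    field_simp
    ring
  rw [h1, h2, div_div_div_cancel_right₀ (by positivity), eq_sub_iff_add_eq, ← add_div,
    div_eq_one_iff_eq hden.ne']
  ring

/-- The limit of `V` for `θ = 0`, where `p` and `s` are the limits of `(-1) ^ N` and
`(-1) ^ n_t`. -/
def VLimitZero (ρ T p s t : ℝ) : ℝ :=
  (s * 3 * Real.exp (3 * ρ * (T - t)) + s * 6 * Real.exp (3 * ρ * (2 * T - t))
      + Real.exp (6 * ρ * T) * (6 * ρ * (T - t) + 4) + p * (3 * ρ * (T - t))
      + p * (2 * Real.exp (3 * ρ * T)) + p * (4 * Real.exp (3 * ρ * t))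
      - 4 * Real.exp (3 * ρ * (T + t)) + p * 3) /
    (2 * Real.exp (6 * ρ * T) * (3 * ρ * T + 5) + (2 * p - 1) * Real.exp (3 * ρ * T)
      + p * (3 * ρ * T) + p * 7)

lemma VLimitZero_one (ρ T s t : ℝ) : VLimitZero ρ T 1 s t = f ρ T s t := by
  rw [VLimitZero, f]
  congr 1 <;> ring

lemma VLimitZero_neg_one (ρ T s t : ℝ) : VLimitZero ρ T (-1) s t = g ρ T s t := by
  rw [VLimitZero, g]
  congr 1 <;> ring

lemma VLimitZero_denominator_pos {ρ T p : ℝ} (hρ : 0 < ρ) (hT : 0 < T) (hp : |p| ≤ 1) :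
    0 < 2 * Real.exp (6 * ρ * T) * (3 * ρ * T + 5) + (2 * p - 1) * Real.exp (3 * ρ * T)
      + p * (3 * ρ * T) + p * 7 := by
  obtain ⟨h1, h2⟩ := abs_le.mp hp
  have hE : 1 < Real.exp (3 * ρ * T) := Real.one_lt_exp_iff.mpr (by positivity)
  have h6 : Real.exp (6 * ρ * T) = Real.exp (3 * ρ * T) ^ 2 := by
    rw [← Real.exp_nat_mul]; congr 1; push_cast; ring
  rw [h6]
  set E := Real.exp (3 * ρ * T)
  have hr : 0 < ρ * T := mul_pos hρ hT
  have hE2 : E < E ^ 2 := by nlinarith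
  nlinarith [mul_pos hr (by linarith : 0 < E ^ 2 - 1), mul_nonneg hr.le (by linarith : 0 ≤ p + 1),
    mul_nonneg (by linarith : 0 ≤ E) (by linarith : 0 ≤ p + 1)]

lemma VLimitZero_ne {ρ T p t : ℝ} (hρ : 0 < ρ) (hT : 0 < T) (hp : |p| ≤ 1) :
    VLimitZero ρ T p 1 t ≠ VLimitZero ρ T p (-1) t := by
  have hD := VLimitZero_denominator_pos hρ hT hp
  rw [VLimitZero, VLimitZero, Ne, div_left_inj' hD.ne']
  have h1 := Real.exp_pos (3 * ρ * (T - t))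
  have h2 := Real.exp_pos (3 * ρ * (2 * T - t))
  intro h
  linarith

lemma tendsto_lowerRoot_pow {ι : Type*} {l : Filter ι} {K m : ι → ℕ} {ρ T τ s : ℝ}
    (hK : Tendsto K l atTop) (hm : Tendsto (fun i => (m i : ℝ) / K i) l (𝓝 τ))
    (hs : ∀ᶠ i in l, (-1 : ℝ) ^ m i = s) :
    Tendsto (fun i => lowerRoot (decay ρ T (K i)) (3 / 2) ^ m i) l
      (𝓝 (s * (Real.exp (3 * (ρ * T) * τ))⁻¹)) := by
  have h := ((tendsto_upperRoot_pow ρ T (d := 3 / 2) (by norm_num) hK hm).inv₀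
    (Real.exp_ne_zero _)).const_mul s
  refine h.congr' ?_
  filter_upwards [hs] with i hi
  rw [lowerRoot_three_halves (decay_pos _ _ _), ← hi, neg_pow (_)⁻¹, inv_pow]

lemma tendsto_V_zero {ι : Type*} {l : Filter ι} {K : ι → ℕ} {ρ T t p s : ℝ} (hρ : 0 < ρ)
    (hT : 0 < T) (ht0 : 0 ≤ t) (ht : t ≤ T) (hp : |p| ≤ 1) (hK : Tendsto K l atTop)
    (hpK : ∀ᶠ i in l, (-1 : ℝ) ^ K i = p)
    (hs : ∀ᶠ i in l, (-1 : ℝ) ^ numTrades T (K i) t = s) :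
    Tendsto (fun i => V ρ T 0 (K i) t) l (𝓝 (VLimitZero ρ T p s t)) := by
  have hE : 1 < Real.exp (3 * ρ * T) := Real.one_lt_exp_iff.mpr (by positivity)
  -- The sign is `-p`, since the exponent is N + 1 while `p` records the parity of N.
  have lη := tendsto_lowerRoot_pow (ρ := ρ) (T := T) (s := -p) hK (tendsto_succ_div hK)
    (hpK.mono fun i hi => by rw [pow_succ, hi]; ring)
  have lζ := tendsto_lowerRoot_pow (ρ := ρ) (T := T) hK
    ((tendsto_numTrades_div hT ht0).comp hK) hs
  rw [show 3 * (ρ * T) * 1 = 3 * ρ * T by ring] at lη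
  rw [show 3 * (ρ * T) * (t / T) = 3 * ρ * t by field_simp] at lζ
  have h32 : (3 / 2 : ℝ) = 3 / 2 + 2 * 0 := by norm_num
  rw [h32] at lη lζ
  have hη : |-p * (Real.exp (3 * ρ * T))⁻¹| < 1 := by
    rw [abs_mul, abs_neg, abs_inv, abs_of_pos (Real.exp_pos _)]
    exact lt_of_le_of_lt (mul_le_of_le_one_left (inv_nonneg.mpr (Real.exp_pos _).le) hp)
      (inv_lt_one_of_one_lt₀ hE)
  have h := tendsto_V hρ hT le_rfl ht0 ht hK lη lζ hη
  convert h using 2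
  have hD := VLimitZero_denominator_pos hρ hT hp
  have h6 : Real.exp (6 * ρ * T) = Real.exp (3 * ρ * T) ^ 2 := by
    rw [← Real.exp_nat_mul]; congr 1; push_cast; ring
  have e1 : Real.exp (3 * ρ * (T - t)) = Real.exp (3 * ρ * T) / Real.exp (3 * ρ * t) := by
    rw [← Real.exp_sub]; congr 1; ring
  have e2 : Real.exp (3 * ρ * (2 * T - t)) = Real.exp (3 * ρ * T) ^ 2 / Real.exp (3 * ρ * t) := by
    rw [← h6, ← Real.exp_sub]; congr 1; ring
  have e3 : Real.exp (3 * ρ * (T + t)) = Real.exp (3 * ρ * T) * Real.exp (3 * ρ * t) := by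
    rw [← Real.exp_add]; congr 1; ring
  have he : 0 < Real.exp (3 * ρ * t) := Real.exp_pos _
  rw [VLimitZero, e1, e2, e3]
  rw [h6] at hD ⊢
  set E := Real.exp (3 * ρ * T)
  set e := Real.exp (3 * ρ * t)
  have hE0 : 0 < E := by linarith
  have hEp : 0 < 2 * E ^ 2 + p := by nlinarith [(abs_le.mp hp).1]
  have hEp' : 2 * E - -p * E⁻¹ = (2 * E ^ 2 + p) / E := by field_simp; ring
  obtain ⟨Q, hQ⟩ : ∃ Q, Q = 2 * E ^ 2 + p := ⟨_, rfl⟩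
  rw [← hQ] at hEp hEp'
  have h1 : nuLimit (ρ * T) E (-p * E⁻¹) (t / T) e (s * e⁻¹) =
      (3 * (ρ * t) * Q + 4 * (E - p) * (e - 1) + 3 * E * (2 * E + 1) * (1 - s / e)) /
        (3 * Q) := by
    rw [nuLimit, hEp']
    field_simp
    rw [hQ]
    ring
  have h2 : nuLimit (ρ * T) E (-p * E⁻¹) 1 E (-p * E⁻¹) =
      (2 * E ^ 2 * (3 * ρ * T + 5) + (2 * p - 1) * E + p * (3 * ρ * T) + p * 7) /
        (3 * Q) := by
    rw [nuLimit, hEp']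
    field_simp
    rw [hQ]
    ring
  rw [h1, h2, div_div_div_cancel_right₀ (by positivity), eq_sub_iff_add_eq, ← add_div,
    div_eq_one_iff_eq hD.ne']
  field_simp
  rw [hQ]
  ring

lemma tendsto_two_mul_add (j : ℕ) : Tendsto (fun i : ℕ => 2 * i + j) atTop atTop :=
  tendsto_atTop_mono (fun i => by simp only [id]; omega) tendsto_id

lemma neg_one_pow_two_mul_add (i j : ℕ) : (-1 : ℝ) ^ (2 * i + j) = (-1) ^ j := by
  rw [pow_add, pow_mul]
  norm_num

lemma abs_neg_one_pow_le (j : ℕ) : |(-1 : ℝ) ^ j| ≤ 1 := by simp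

lemma exactlyTwoClusterPoints_V {ρ T t : ℝ} (hρ : 0 < ρ) (hT : 0 < T) (ht0 : 0 < t) (ht : t < T)
    (j : ℕ) : ExactlyTwoClusterPoints (fun N : ℕ => V ρ T 0 (2 * N + j) t)
      (VLimitZero ρ T ((-1) ^ j) 1 t) (VLimitZero ρ T ((-1) ^ j) (-1) t) := by
  obtain ⟨he, ho⟩ := frequently_parity_numTrades hT ht0 ht j
  refine exactlyTwoClusterPoints_of_tendsto (VLimitZero_ne hρ hT (abs_neg_one_pow_le j)) he ho ?_ ?_
  · refine tendsto_V_zero hρ hT ht0.le ht.le (abs_neg_one_pow_le j)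
      ((tendsto_two_mul_add j).mono_left inf_le_left)
      (Eventually.of_forall fun i => neg_one_pow_two_mul_add i j) ?_
    filter_upwards [mem_inf_of_right (mem_principal_self _)] with i hi
    exact Even.neg_one_pow hi
  · refine tendsto_V_zero hρ hT ht0.le ht.le (abs_neg_one_pow_le j)
      ((tendsto_two_mul_add j).mono_left inf_le_left)
      (Eventually.of_forall fun i => neg_one_pow_two_mul_add i j) ?_
    filter_upwards [mem_inf_of_right (mem_principal_self _)] with i hi
    exact Odd.neg_one_pow (Nat.not_even_iff_odd.mp hi)

/-- At t = T one has n_t = N, so the two signs coincide: plus for even N, minus for odd N. -/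
lemma tendsto_V_terminal {ρ T : ℝ} (hρ : 0 < ρ) (hT : 0 < T) (j : ℕ) :
    Tendsto (fun N : ℕ => V ρ T 0 (2 * N + j) T) atTop
      (𝓝 (VLimitZero ρ T ((-1) ^ j) ((-1) ^ j) T)) :=
  tendsto_V_zero hρ hT hT.le le_rfl (abs_neg_one_pow_le j) (tendsto_two_mul_add j)
    (Eventually.of_forall fun i => neg_one_pow_two_mul_add i j)
    (Eventually.of_forall fun i => by rw [numTrades_self hT, neg_one_pow_two_mul_add])

/-! ### The limits of `W` for θ > 0 and θ = 0 -/

lemma abs_one_sub_inv_lt_one {θ : ℝ} (hθ : 0 < θ) : |1 - 1 / (1 / 2 + 2 * θ)| < 1 := by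
  have h : 0 < 1 / 2 + 2 * θ := by linarith
  have h1 : 0 < 1 / (1 / 2 + 2 * θ) := by positivity
  have h2 : 1 / (1 / 2 + 2 * θ) < 2 := by rw [div_lt_iff₀ h]; linarith
  rw [abs_lt]
  constructor <;> linarith

lemma tendsto_W_of_pos {ρ T θ t : ℝ} (hρ : 0 < ρ) (hT : 0 < T) (hθ : 0 < θ) (ht0 : 0 ≤ t)
    (ht : t < T) : Tendsto (fun N : ℕ => W ρ T θ N t) atTop (𝓝 (WLimit ρ T t)) := by
  have hq := abs_one_sub_inv_lt_one hθ
  have lr := (tendsto_decay ρ T).mul_const (1 - 1 / (1 / 2 + 2 * θ))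
  rw [one_mul] at lr
  have hτ : 0 < 1 - t / T := by
    have := (div_lt_one hT).mpr ht
    linarith
  have h : Tendsto (fun N : ℕ => W ρ T θ N t) atTop (𝓝 _) :=
    tendsto_W hρ hT hθ.le ht0 ht.le tendsto_id
    (tendsto_pow_zero_of_tendsto lr hq (tendsto_add_atTop_nat 1))
    (tendsto_pow_zero_of_tendsto lr hq (tendsto_atTop_of_tendsto_div hτ tendsto_id
      (tendsto_remaining_div hT ht0 ht.le tendsto_id))) (by positivity)
  simpa only [sub_zero, WLimit] using h

lemma tendsto_W_terminal_of_pos {ρ T θ : ℝ} (hρ : 0 < ρ) (hT : 0 < T) (hθ : 0 < θ) :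
    Tendsto (fun N : ℕ => W ρ T θ N T) atTop
      (𝓝 (1 / ((2 * θ + 1 / 2) * (ρ * T + 1)))) := by
  have hq := abs_one_sub_inv_lt_one hθ
  have lr := (tendsto_decay ρ T).mul_const (1 - 1 / (1 / 2 + 2 * θ))
  rw [one_mul] at lr
  have h : Tendsto (fun N : ℕ => W ρ T θ N T) atTop (𝓝 _) :=
    tendsto_W hρ hT hθ.le hT.le le_rfl tendsto_id
    (tendsto_pow_zero_of_tendsto lr hq (tendsto_add_atTop_nat 1))
    -- Exactly one trade remains at t = T, so the power has exponent 1 and does not vanish; this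
    -- gives the separate terminal value.
    (lr.congr fun N => by
      rw [numTrades_self hT, Nat.add_sub_cancel_left, pow_one]) (by positivity)
  convert h using 2
  have h1 : 0 < 1 / 2 + 2 * θ := by positivity
  have h2 : 0 < ρ * T + 1 := by positivity
  rw [sub_self, mul_zero, zero_add, sub_sub_cancel, sub_zero, div_div, add_comm (2 * θ)]

/-- The limit of `W` for `θ = 0`, where `p` and `s` are the limits of `(-1) ^ N` and
`(-1) ^ (N - n_t)`. -/
def WLimitZero (ρ T p s t : ℝ) : ℝ :=
  (1 + ρ * (T - t) + s * Real.exp (-ρ * (T - t))) / (1 + ρ * T + p * Real.exp (-ρ * T))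

lemma WLimitZero_one (ρ T s t : ℝ) : WLimitZero ρ T 1 s t = phi ρ T s t := by
  rw [WLimitZero, phi, one_mul]

lemma WLimitZero_neg_one (ρ T s t : ℝ) : WLimitZero ρ T (-1) s t = psi ρ T s t := by
  rw [WLimitZero, psi, neg_one_mul, ← sub_eq_add_neg]

lemma WLimitZero_denominator_pos {ρ T p : ℝ} (hρ : 0 < ρ) (hT : 0 < T) (hp : |p| ≤ 1) :
    0 < 1 + ρ * T + p * Real.exp (-ρ * T) := by
  have hr : 0 < ρ * T := mul_pos hρ hT
  have h1 : Real.exp (-ρ * T) < 1 := Real.exp_lt_one_iff.mpr (by linarith)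
  have h2 := Real.exp_pos (-ρ * T)
  nlinarith [(abs_le.mp hp).1]

lemma WLimitZero_ne {ρ T p t : ℝ} (hρ : 0 < ρ) (hT : 0 < T) (hp : |p| ≤ 1) :
    WLimitZero ρ T p 1 t ≠ WLimitZero ρ T p (-1) t := by
  rw [WLimitZero, WLimitZero, Ne, div_left_inj' (WLimitZero_denominator_pos hρ hT hp).ne']
  have h1 := Real.exp_pos (-ρ * (T - t))
  intro h
  linarith

lemma tendsto_W_zero {ι : Type*} {l : Filter ι} {K : ι → ℕ} {ρ T t p s : ℝ} (hρ : 0 < ρ)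
    (hT : 0 < T) (ht0 : 0 ≤ t) (ht : t ≤ T) (hp : |p| ≤ 1) (hK : Tendsto K l atTop)
    (hpK : ∀ᶠ i in l, (-1 : ℝ) ^ K i = p)
    (hs : ∀ᶠ i in l, (-1 : ℝ) ^ (K i - numTrades T (K i) t) = s) :
    Tendsto (fun i => W ρ T 0 (K i) t) l (𝓝 (WLimitZero ρ T p s t)) := by
  have key : ∀ (m : ι → ℕ) (τ q : ℝ), Tendsto (fun i => (m i : ℝ) / K i) l (𝓝 τ) →
      (∀ᶠ i in l, (-1 : ℝ) ^ m i = q) →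
      Tendsto (fun i => (decay ρ T (K i) * (1 - 1 / (1 / 2 + 2 * 0))) ^ m i) l
        (𝓝 (q * Real.exp (-(ρ * T) * τ))) := by
    intro m τ q hm hq
    refine ((tendsto_decay_pow ρ T hm).const_mul q).congr' ?_
    filter_upwards [hq] with i hi
    -- At θ = 0 the ratio is exactly minus the decay factor, so its powers split into a sign and a
    -- decaying exponential.
    rw [show (1 - 1 / (1 / 2 + 2 * 0) : ℝ) = -1 by norm_num, mul_pow, hi, mul_comm]
  have lη := key _ _ (-p) (tendsto_succ_div hK)
    (hpK.mono fun i hi => by rw [pow_succ, hi]; ring)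
  have lζ := key _ _ (-s) (tendsto_remaining_div hT ht0 ht hK)
    (hs.mono fun i hi => by
      rw [Nat.sub_add_comm (numTrades_le hT (K i) ht), pow_succ, hi]; ring)
  rw [show -(ρ * T) * (1 - t / T) = -ρ * (T - t) by field_simp] at lζ
  rw [show -(ρ * T) * 1 = -ρ * T by ring] at lη
  have hD := WLimitZero_denominator_pos hρ hT hp
  have h := tendsto_W hρ hT le_rfl ht0 ht hK lη lζ (by linarith)
  convert h using 2
  rw [WLimitZero]
  congr 1 <;> ring

lemma exactlyTwoClusterPoints_W {ρ T t : ℝ} (hρ : 0 < ρ) (hT : 0 < T) (ht0 : 0 < t) (ht : t < T)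
    (j : ℕ) : ExactlyTwoClusterPoints (fun N : ℕ => W ρ T 0 (2 * N + j) t)
      (WLimitZero ρ T ((-1) ^ j) 1 t) (WLimitZero ρ T ((-1) ^ j) (-1) t) := by
  obtain ⟨he, ho⟩ := frequently_parity_numTrades hT ht0 ht j
  -- The sign is now governed by N - n_t; for odd `j` this exchanges the roles of even and odd n_t.
  have hiff : ∀ i, Even (2 * i + j - numTrades T (2 * i + j) t) ↔
      (Even j ↔ Even (numTrades T (2 * i + j) t)) := by
    intro i
    rw [Nat.even_sub (numTrades_le hT _ ht.le), Nat.even_add]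
    simp
  have hfreq : (∃ᶠ i : ℕ in atTop, Even (2 * i + j - numTrades T (2 * i + j) t)) ∧
      ∃ᶠ i : ℕ in atTop, ¬ Even (2 * i + j - numTrades T (2 * i + j) t) := by
    simp only [hiff]
    by_cases hj : Even j
    · simp only [hj, true_iff]
      exact ⟨he, ho⟩
    · simp only [hj, false_iff, not_not]
      exact ⟨ho, he⟩
  refine exactlyTwoClusterPoints_of_tendsto (WLimitZero_ne hρ hT (abs_neg_one_pow_le j))
    hfreq.1 hfreq.2 ?_ ?_
  · refine tendsto_W_zero hρ hT ht0.le ht.le (abs_neg_one_pow_le j)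
      ((tendsto_two_mul_add j).mono_left inf_le_left)
      (Eventually.of_forall fun i => neg_one_pow_two_mul_add i j) ?_
    filter_upwards [mem_inf_of_right (mem_principal_self _)] with i hi
    exact Even.neg_one_pow hi
  · refine tendsto_W_zero hρ hT ht0.le ht.le (abs_neg_one_pow_le j)
      ((tendsto_two_mul_add j).mono_left inf_le_left)
      (Eventually.of_forall fun i => neg_one_pow_two_mul_add i j) ?_
    filter_upwards [mem_inf_of_right (mem_principal_self _)] with i hi
    exact Odd.neg_one_pow (Nat.not_even_iff_odd.mp hi)

/-- At t = T the exponent N - n_t is 0, so the sign is plus for both parities of N, unlike for `V`.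
-/
lemma tendsto_W_terminal {ρ T : ℝ} (hρ : 0 < ρ) (hT : 0 < T) (j : ℕ) :
    Tendsto (fun N : ℕ => W ρ T 0 (2 * N + j) T) atTop
      (𝓝 (WLimitZero ρ T ((-1) ^ j) 1 T)) :=
  tendsto_W_zero hρ hT hT.le le_rfl (abs_neg_one_pow_le j) (tendsto_two_mul_add j)
    (Eventually.of_forall fun i => neg_one_pow_two_mul_add i j)
    (Eventually.of_forall fun i => by rw [numTrades_self hT, Nat.sub_self, pow_zero])

end MarketImpact

end

theorem mainTheorem3 (ρ T θ : ℝ) (hρ : 0 < ρ) (hT : 0 < T) (hθ : 0 ≤ θ) :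
    -- the strategies are well defined and normalized
    (∀ N : ℕ, 1 ≤ N →
      IsUnit (MarketImpact.nuMatrix ρ T θ N).det ∧
      IsUnit (MarketImpact.omegaMatrix ρ T θ N).det ∧
      ∑ k, MarketImpact.v ρ T θ N k = 1 ∧
      ∑ k, MarketImpact.w ρ T θ N k = 1) ∧
    -- (a)
    (0 < θ →
      (∀ N : ℕ, 1 ≤ N → MarketImpact.V ρ T θ N 0 = 1) ∧
      ∀ t : ℝ, 0 < t → t ≤ T →
        Filter.Tendsto (fun N : ℕ => MarketImpact.V ρ T θ N t) Filter.atTop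
          (nhds (MarketImpact.VLimit ρ T t))) ∧
    -- (b)
    (θ = 0 →
      (∀ N : ℕ, 1 ≤ N → MarketImpact.V ρ T θ N 0 = 1) ∧
      (∀ t : ℝ, 0 < t → t < T →
        MarketImpact.ExactlyTwoClusterPoints (fun N : ℕ => MarketImpact.V ρ T θ (2 * N) t)
          (MarketImpact.f ρ T 1 t) (MarketImpact.f ρ T (-1) t) ∧
        MarketImpact.ExactlyTwoClusterPoints (fun N : ℕ => MarketImpact.V ρ T θ (2 * N + 1) t)
          (MarketImpact.g ρ T 1 t) (MarketImpact.g ρ T (-1) t)) ∧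
      Filter.Tendsto (fun N : ℕ => MarketImpact.V ρ T θ (2 * N) T) Filter.atTop
        (nhds (MarketImpact.f ρ T 1 T)) ∧
      Filter.Tendsto (fun N : ℕ => MarketImpact.V ρ T θ (2 * N + 1) T) Filter.atTop
        (nhds (MarketImpact.g ρ T (-1) T))) ∧
    -- (c)
    (0 < θ →
      (∀ t : ℝ, 0 ≤ t → t < T →
        Filter.Tendsto (fun N : ℕ => MarketImpact.W ρ T θ N t) Filter.atTop
          (nhds (MarketImpact.WLimit ρ T t))) ∧
      Filter.Tendsto (fun N : ℕ => MarketImpact.W ρ T θ N T) Filter.atTop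
        (nhds (1 / ((2 * θ + 1 / 2) * (ρ * T + 1))))) ∧
    -- (d)
    (θ = 0 →
      (∀ N : ℕ, 1 ≤ N → MarketImpact.W ρ T θ N 0 = 1) ∧
      (∀ t : ℝ, 0 < t → t < T →
        MarketImpact.ExactlyTwoClusterPoints (fun N : ℕ => MarketImpact.W ρ T θ (2 * N) t)
          (MarketImpact.phi ρ T 1 t) (MarketImpact.phi ρ T (-1) t) ∧
        MarketImpact.ExactlyTwoClusterPoints (fun N : ℕ => MarketImpact.W ρ T θ (2 * N + 1) t)
          (MarketImpact.psi ρ T 1 t) (MarketImpact.psi ρ T (-1) t)) ∧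
      Filter.Tendsto (fun N : ℕ => MarketImpact.W ρ T θ (2 * N) T) Filter.atTop
        (nhds (MarketImpact.phi ρ T 1 T)) ∧
      Filter.Tendsto (fun N : ℕ => MarketImpact.W ρ T θ (2 * N + 1) T) Filter.atTop
        (nhds (MarketImpact.psi ρ T 1 T))) := by
  refine ⟨fun N hN => ⟨?_, ?_, MarketImpact.sum_v_eq_one hρ hT hθ hN,
      MarketImpact.sum_w_eq_one hρ hT hθ hN⟩,
    fun hpos => ⟨fun N _ => MarketImpact.V_zero ρ T θ N,
      fun t ht0 ht => MarketImpact.tendsto_V_of_pos hρ hT hpos ht0 ht⟩, ?_,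
    fun hpos => ⟨fun t ht0 ht => MarketImpact.tendsto_W_of_pos hρ hT hpos ht0 ht,
      MarketImpact.tendsto_W_terminal_of_pos hρ hT hpos⟩, ?_⟩
  · exact MarketImpact.isUnit_det_of_dotProduct_pos fun z hz =>
      MarketImpact.dotProduct_nuMatrix_pos hρ hT hθ hN hz
  · exact MarketImpact.isUnit_det_of_dotProduct_pos fun z hz =>
      MarketImpact.dotProduct_omegaMatrix_pos hρ hT hθ hN hz
  · rintro rfl
    refine ⟨fun N _ => MarketImpact.V_zero ρ T 0 N, fun t ht0 ht => ⟨?_, ?_⟩, ?_, ?_⟩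
    · simpa only [pow_zero, add_zero, MarketImpact.VLimitZero_one] using
        MarketImpact.exactlyTwoClusterPoints_V hρ hT ht0 ht 0
    · simpa only [pow_one, MarketImpact.VLimitZero_neg_one] using
        MarketImpact.exactlyTwoClusterPoints_V hρ hT ht0 ht 1
    · simpa only [pow_zero, add_zero, MarketImpact.VLimitZero_one] using
        MarketImpact.tendsto_V_terminal hρ hT 0
    · simpa only [pow_one, MarketImpact.VLimitZero_neg_one] using
        MarketImpact.tendsto_V_terminal hρ hT 1
  · rintro rfl
    refine ⟨fun N _ => MarketImpact.W_zero ρ T 0 N, fun t ht0 ht => ⟨?_, ?_⟩, ?_, ?_⟩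
    · simpa only [pow_zero, add_zero, MarketImpact.WLimitZero_one] using
        MarketImpact.exactlyTwoClusterPoints_W hρ hT ht0 ht 0
    · simpa only [pow_one, MarketImpact.WLimitZero_neg_one] using
        MarketImpact.exactlyTwoClusterPoints_W hρ hT ht0 ht 1
    · simpa only [pow_zero, add_zero, MarketImpact.WLimitZero_one] using
        MarketImpact.tendsto_W_terminal hρ hT 0
    · simpa only [pow_one, MarketImpact.WLimitZero_neg_one] using
        MarketImpact.tendsto_W_terminal hρ hT 1
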